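/- **Setting.** Let $S$ and $A$ be (standard) Borel spaces, let $K\subseteq S\times A$ be a Borel set containing the graph of a measurable map $S\to A$, and put $A(x)=\{a:(x,a)\in K\}$. Let $q(dy\mid x,a)$, $(x,a)\in K$, be a finite signed kernel on $S$ with $q(\Gamma\mid x,a)\ge 0$ whenever $x\notin\Gamma$, with $q(S\mid x,a)=0$ and $\bar q_x:=\sup_{a\in A(x)}q_x(a)<\infty$ for every $x\in S$, where $q_x(a):=-q(\{x\}\mid x,a)$; put $q(\cdot\mid x,a)=0$ for $(x,a)\notin K$. Let $\alpha>0$. Let $\Omega$ be the set of sequences $\omega=(x_0,\theta_1,x_1,\theta_2,x_2,\dots)$ with $x_0\in S$ such that either all $\theta_n\in(0,\infty)$ and all $x_n\in S$, or this is so up to some index and all later pairs are $(\theta_n,x_n)=(\infty,x_\infty)$, with an isolated point $x_\infty\notin S$. Put $T_0=0$, $T_m=\theta_1+\dots+\theta_m$, $T_\infty=\lim_m T_m$; let $\xi_t=x_m$ for $T_m\le t<T_{m+1}$ and $\xi_t=x_\infty$ for $t\ge T_\infty$; let $\xi_{0-}=x_0$, $\xi_{t-}=x_m$ for $T_m<t\le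 T_{m+1}$ and $\xi_{t-}=x_\infty$ for $t\ge T_\infty$. Let $\mathcal F_t=\sigma(\{T_m\le s,\,x_m\in\Gamma\}:\Gamma\in\mathcal B(S),\,s\le t,\,m\ge 0)$. A *randomized history-dependent policy* $\pi$ is a transition probability $\pi(da\mid\omega,t)$ from $\Omega\times[0,\infty)$, equipped with the predictable $\sigma$-algebra of $(\mathcal F_t)$, to $A\cup\{a_\infty\}$ ($a_\infty\notin A$ an isolated point), concentrated on $A(\xi_{t-}(\omega))$, where $A(x_\infty):=\{a_\infty\}$. For a history $h_k=(x_0,\theta_1,\dots,\theta_k,x_k)$ with $\theta_k<\infty$ let $$\Lambda^k(\Gamma\mid h_k,s)=\int_A\pi(da\mid h_k,T_k+s)\,q(\Gamma\setminus\{x_k\}\mid x_k,a),$$ where $\pi(\cdot\mid h_k,T_k+s)$ is the value of $\pi$ at time $T_k+s$ on paths with history $h_k$ and $T_{k+1}\ge T_k+s$. For $x\in S$, $P_x^\pi$ is the probability measure on $\Omega$ under which $x_0=x$ and, given $h_k$ with $\theta_k<\infty$, the pair $(\theta_{k+1},x_{k+1})$ has law $\Lambda^k(dy\mid h_k,s)\,e^{-\int_0^s\Lambda^k(S\mid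 h_k,v)dv}\,ds$ on $(0,\infty)\times S$ and equals $(\infty,x_\infty)$ with probability $e^{-\int_0^\infty\Lambda^k(S\mid h_k,v)dv}$. $E_x^\pi$ is the expectation under $P_x^\pi$. Functions on $S$ are extended by $0$ to $x_\infty$. **Theorem.** Suppose the following conditions hold. 1. There are a measurable $w:S\to[1,\infty)$ and constants $\rho,b\ge 0$ such that: (a) there are measurable sets $S_0\subseteq S_1\subseteq\cdots$ with $\bigcup_l S_l=S$ and $\lim_{l\to\infty}\inf_{x\in S\setminus S_l}w(x)=\infty$ (where $\inf\emptyset=\infty$); (b) $\int_S q(dy\mid x,a)w(y)\le\rho w(x)+b$ for all $x\in S$, $a\in A(x)$; (c) $\sup_{x\in S_l}\bar q_x<\infty$ for every $l$. 2. There are a measurable $w':S\to[1,\infty)$ and constants $L',\rho',b'\ge 0$ such that: (a) $(\bar q_x+1)w'(x)\le L'w(x)$ for all $x\in S$; (b) $\int_S q(dy\mid x,a)w'(y)\le\rho' w'(x)+b'$ for all $x\in S$, $a\in A(x)$. Then for every measurable $u:S\to\mathbb R$ with $\sup_{x\in S}|u(x)|/w'(x)<\infty$, every randomized history-dependent policy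 $\pi$, every $x\in S$ and every $t\ge 0$, one has $P_x^\pi(\xi_t\in S)=1$, all integrals below are well defined and finite, and $$E_x^\pi[u(\xi_t)]-u(x)=E_x^\pi\left[\int_0^t\int_A\pi(da\mid\omega,v)\int_S q(dy\mid\xi_v,a)\,u(y)\,dv\right],$$ $$E_x^\pi[u(\xi_t)]\,e^{-\alpha t}-u(x)=E_x^\pi\left[\int_0^t e^{-\alpha v}\left\{-\alpha u(\xi_v)+\int_A\pi(da\mid\omega,v)\int_S q(dy\mid\xi_v,a)\,u(y)\right\}dv\right].$$ -/

import Mathlib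

open MeasureTheory ProbabilityTheory Set Filter Topology
open scoped NNReal ENNReal

noncomputable section

namespace CTMDP

/-! ### Two facts used to see that the law of the process is well defined -/

/-- `e^{-r}` for `r ∈ [0, ∞]`, with `e^{-∞} = 0`. -/
def expNeg (r : ℝ≥0∞) : ℝ≥0∞ := EReal.exp (-(r : EReal))

theorem measurable_expNeg : Measurable expNeg :=
  EReal.measurable_exp.comp (measurable_coe_ennreal_ereal.neg)

theorem continuous_expNeg : Continuous expNeg :=
  ENNReal.continuous_exp.comp (continuous_coe_ennreal_ereal.neg)

theorem expNeg_ofReal {r : ℝ} (hr : 0 ≤ r) :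
    expNeg (ENNReal.ofReal r) = ENNReal.ofReal (Real.exp (-r)) := by
  rw [expNeg, EReal.coe_ennreal_ofReal, max_eq_left hr, ← EReal.coe_neg, EReal.exp_coe]

/-- A kernel all of whose measures are finite is s-finite. -/
theorem isSFiniteKernel_of_finite {X Y : Type*} [MeasurableSpace X] [MeasurableSpace Y]
    (κ : Kernel X Y) (h : ∀ x, κ x univ < ∞) : IsSFiniteKernel κ := by
  classical
  let s : ℕ → Set X := fun n => {x | ⌊(κ x univ).toReal⌋₊ = n}
  have hs : ∀ n, MeasurableSet (s n) := fun n =>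
    (Nat.measurable_floor.comp (κ.measurable_coe MeasurableSet.univ).ennreal_toReal)
      (measurableSet_singleton n)
  refine ⟨⟨fun n => Kernel.piecewise (hs n) κ 0, fun n => ⟨⟨(n + 1 : ℕ), by simp, ?_⟩⟩, ?_⟩⟩
  · intro x
    rw [Kernel.piecewise_apply]
    split_ifs with hx
    · have h1 : (κ x univ).toReal < ⌊(κ x univ).toReal⌋₊ + 1 := Nat.lt_floor_add_one _
      have hx' : ⌊(κ x univ).toReal⌋₊ = n := hx
      rw [hx'] at h1
      rw [← ENNReal.ofReal_toReal (h x).ne, ← ENNReal.ofReal_natCast]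
      exact ENNReal.ofReal_le_ofReal (by push_cast; exact h1.le)
    · simp
  · ext x t ht
    rw [Kernel.sum_apply' _ _ ht, tsum_eq_single ⌊(κ x univ).toReal⌋₊]
    · rw [Kernel.piecewise_apply, if_pos (show x ∈ s _ from rfl)]
    · intro n hn
      rw [Kernel.piecewise_apply, if_neg (fun hx => hn hx.symm)]
      simp

/-- Total mass one of the sojourn-time law with bounded hazard rate `g`. -/
theorem lintegral_hazard {g : ℝ → ℝ≥0∞} (hg : Measurable g) {C : ℝ≥0} (hC : ∀ v, g v ≤ C) :
    (∫⁻ u in Ioi (0 : ℝ), expNeg (∫⁻ v in Ioc 0 u, g v) * g u)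
      + expNeg (∫⁻ v in Ioi (0 : ℝ), g v) = 1 := by
  set f : ℝ → ℝ := fun v => (g v).toReal with hf
  have hgf : ∀ v, g v = ENNReal.ofReal (f v) := fun v =>
    (ENNReal.ofReal_toReal (ne_top_of_le_ne_top ENNReal.coe_ne_top (hC v))).symm
  have hfm : Measurable f := hg.ennreal_toReal
  have hf0 : ∀ v, 0 ≤ f v := fun v => ENNReal.toReal_nonneg
  have hfC : ∀ v, f v ≤ C := fun v => ENNReal.toReal_le_coe_of_le_coe (hC v)
  have hfl : LocallyIntegrable f volume :=
    (locallyIntegrable_const (C : ℝ)).mono hfm.aestronglyMeasurable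
      (Eventually.of_forall fun v => by
        rw [Real.norm_of_nonneg (hf0 v)]; exact (hfC v).trans (le_abs_self _))
  have hfi : ∀ a b, IntervalIntegrable f volume a b := fun a b =>
    intervalIntegrable_iff.mpr <|
      (hfl.integrableOn_isCompact isCompact_uIcc).mono_set uIoc_subset_uIcc
  set F : ℝ → ℝ := fun u => ∫ v in (0 : ℝ)..u, f v with hF
  have hFcont : Continuous F := intervalIntegral.continuous_primitive hfi 0
  have hF0 : ∀ u, 0 ≤ u → 0 ≤ F u := fun u hu =>
    intervalIntegral.integral_nonneg hu fun v _ => hf0 v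
  have hG : ∀ u, 0 ≤ u → ∫⁻ v in Ioc 0 u, g v = ENNReal.ofReal (F u) := by
    intro u hu
    rw [hF]
    simp only
    rw [intervalIntegral.integral_of_le hu, ofReal_integral_eq_lintegral_ofReal
      ((hfi 0 u).1) (Eventually.of_forall hf0)]
    simp_rw [hgf]
  have hFac : ∀ T, AbsolutelyContinuousOnInterval F 0 T := fun T =>
    (hfi 0 T).absolutelyContinuousOnInterval_intervalIntegral (by simp)
  have hLip : LipschitzOnWith 1 (fun r : ℝ => Real.exp (-r)) (Ici 0) := by
    refine Convex.lipschitzOnWith_of_nnnorm_deriv_le (s := Ici (0 : ℝ))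
      (fun x _ => by fun_prop) ?_ (convex_Ici 0)
    intro x hx
    have : deriv (fun r : ℝ => Real.exp (-r)) x = -Real.exp (-x) := by
      have := ((hasDerivAt_neg x).exp).deriv
      simpa using this
    rw [this, ← NNReal.coe_le_coe, coe_nnnorm, norm_neg, Real.norm_of_nonneg (Real.exp_nonneg _)]
    simpa using hx
  have hFlip : LipschitzWith C F := by
    refine LipschitzWith.of_dist_le_mul fun a b => ?_
    rw [hF, Real.dist_eq, Real.dist_eq]
    simp only
    rw [intervalIntegral.integral_interval_sub_left (hfi _ _) (hfi _ _)]
    have := intervalIntegral.norm_integral_le_of_norm_le_const (a := b) (b := a) (f := f)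
      (C := C) (fun v _ => by rw [Real.norm_of_nonneg (hf0 v)]; exact hfC v)
    simpa using this
  have key : ∀ T, 0 ≤ T → ∫ u in (0 : ℝ)..T, Real.exp (-F u) * f u = 1 - Real.exp (-F T) := by
    intro T hT
    have hac : AbsolutelyContinuousOnInterval (fun u => Real.exp (-F u)) 0 T := by
      refine LipschitzOnWith.absolutelyContinuousOnInterval (K := 1 * C) ?_
      rw [uIcc_of_le hT]
      exact hLip.comp hFlip.lipschitzOnWith (fun u hu => hF0 u hu.1)
    have h1 := hac.integral_deriv_eq_sub
    have h2 : ∫ u in (0 : ℝ)..T, deriv (fun u => Real.exp (-F u)) u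
        = ∫ u in (0 : ℝ)..T, -(Real.exp (-F u) * f u) := by
      refine intervalIntegral.integral_congr_ae ?_
      filter_upwards [LocallyIntegrable.ae_hasDerivAt_integral hfl] with u hu _
      have := ((hu 0).neg.exp).deriv
      rw [show deriv (fun u => Real.exp (-F u)) u = _ from this]
      simp [hF]
    rw [h2, intervalIntegral.integral_neg] at h1
    have h3 : F 0 = 0 := by simp [hF]
    rw [h3] at h1
    simp at h1
    linarith
  have keyL : ∀ T, 0 ≤ T → (∫⁻ u in Ioc (0 : ℝ) T, expNeg (∫⁻ v in Ioc 0 u, g v) * g u)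
      + expNeg (∫⁻ v in Ioc 0 T, g v) = 1 := by
    intro T hT
    have h1 : ∫⁻ u in Ioc (0 : ℝ) T, expNeg (∫⁻ v in Ioc 0 u, g v) * g u
        = ∫⁻ u in Ioc (0 : ℝ) T, ENNReal.ofReal (Real.exp (-F u) * f u) := by
      refine setLIntegral_congr_fun measurableSet_Ioc fun u hu => ?_
      rw [hG u hu.1.le, expNeg_ofReal (hF0 u hu.1.le), hgf,
        ENNReal.ofReal_mul (Real.exp_nonneg _)]
    have hint : IntervalIntegrable (fun u => Real.exp (-F u) * f u) volume 0 T :=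
      (hfi 0 T).continuousOn_mul (by fun_prop)
    rw [h1, ← ofReal_integral_eq_lintegral_ofReal hint.1
      (Eventually.of_forall fun u => mul_nonneg (Real.exp_nonneg _) (hf0 u)),
      ← intervalIntegral.integral_of_le hT, key T hT, hG T hT, expNeg_ofReal (hF0 T hT),
      ← ENNReal.ofReal_add _ (Real.exp_nonneg _)]
    · simp
    · simpa using hF0 T hT
  have hU : (⋃ n : ℕ, Ioc (0 : ℝ) n) = Ioi 0 := by
    ext x
    simp only [mem_iUnion, mem_Ioc, mem_Ioi]
    exact ⟨fun ⟨_, h, _⟩ => h, fun h => ⟨⌈x⌉₊, h, Nat.le_ceil x⟩⟩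
  have hmono : Monotone fun n : ℕ => Ioc (0 : ℝ) n := fun m n hmn =>
    Ioc_subset_Ioc_right (by exact_mod_cast hmn)
  have hlim : ∀ φ : ℝ → ℝ≥0∞, Tendsto (fun n : ℕ => ∫⁻ u in Ioc (0 : ℝ) n, φ u) atTop
      (𝓝 (∫⁻ u in Ioi (0 : ℝ), φ u)) := by
    intro φ
    have h1 : ∀ s, MeasurableSet s → ∫⁻ u in s, φ u = (volume.withDensity φ) s := fun s hs =>
      (withDensity_apply φ hs).symm
    rw [← hU, h1 _ (MeasurableSet.iUnion fun n => measurableSet_Ioc)]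
    simp_rw [fun n : ℕ => h1 (Ioc (0 : ℝ) n) measurableSet_Ioc]
    exact tendsto_measure_iUnion_atTop hmono
  have hsum := (hlim fun u => expNeg (∫⁻ v in Ioc 0 u, g v) * g u).add
    ((continuous_expNeg.tendsto _).comp (hlim g))
  refine tendsto_nhds_unique hsum ?_
  refine tendsto_const_nhds.congr fun n => ?_
  exact (keyL n (Nat.cast_nonneg n)).symm

/-! ### The model -/

/-- The primitives of a continuous-time Markov decision process with state space `S` and action
space `A`. The transition rate is a signed kernel given `(x, a) ∈ K`, extended by `0` outside of
the (measurable) set `K`. -/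
structure Model (S A : Type*) [MeasurableSpace S] [MeasurableSpace A] where
  /-- the admissible state-action pairs -/
  K : Set (S × A)
  measurableSet_K : MeasurableSet K
  exists_selector : ∃ φ : S → A, Measurable φ ∧ ∀ x, (x, φ x) ∈ K
  /-- the transition rate `q(dy | x, a)` -/
  q : S → A → SignedMeasure S
  measurable_q : ∀ Γ, MeasurableSet Γ → Measurable fun p : S × A => q p.1 p.2 Γ
  q_eq_zero : ∀ x a, (x, a) ∉ K → q x a = 0
  q_nonneg : ∀ x a, (x, a) ∈ K → ∀ Γ, MeasurableSet Γ → x ∉ Γ → 0 ≤ q x a Γ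
  conservative : ∀ x a, (x, a) ∈ K → q x a univ = 0
  stable : ∀ x, BddAbove ((fun a => -q x a {x}) '' {a | (x, a) ∈ K})

/-- `X` with an isolated point adjoined: `Sum.inr ()` is `x_∞` (for states), resp. `a_∞`
(for actions). -/
abbrev Adjoin (X : Type*) := X ⊕ Unit

namespace Model

variable {S A : Type*} [MeasurableSpace S] [MeasurableSpace A] (M : Model S A)

/-- The set `A(x)` of admissible actions. -/
def adm (x : S) : Set A := {a | (x, a) ∈ M.K}

/-- `q_x(a) = -q({x} | x, a)`. -/
def rate (x : S) (a : A) : ℝ := -M.q x a {x}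

/-- `q̄_x = sup_{a ∈ A(x)} q_x(a)`. -/
def maxRate (x : S) : ℝ := sSup (M.rate x '' M.adm x)

/-- `A(x)` for `x ∈ S`, and `A(x_∞) = {a_∞}`. -/
def admExt : Adjoin S → Set (Adjoin A)
  | Sum.inl x => Sum.inl '' M.adm x
  | Sum.inr _ => {Sum.inr ()}

theorem zero_le_restrict_q (x : S) (a : A) : 0 ≤[{x}ᶜ] M.q x a := by
  refine VectorMeasure.restrict_le_restrict_of_subset_le _ _ fun Γ hΓ hx => ?_
  by_cases h : (x, a) ∈ M.K
  · exact M.q_nonneg x a h Γ hΓ fun hxΓ => hx hxΓ rfl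
  · rw [M.q_eq_zero x a h]

theorem measurable_q_section {D : Set (S × S)} (hD : MeasurableSet D) :
    Measurable fun p : S × A => M.q p.1 p.2 (Prod.mk p.1 ⁻¹' D) := by
  induction D, hD using MeasurableSpace.induction_on_inter generateFrom_prod.symm isPiSystem_prod with
  | empty => simp
  | basic t ht =>
    obtain ⟨B, hB, Γ, hΓ, rfl⟩ := ht
    classical
    have : (fun p : S × A => M.q p.1 p.2 (Prod.mk p.1 ⁻¹' B ×ˢ Γ))
        = fun p => if p.1 ∈ B then M.q p.1 p.2 Γ else 0 := by
      ext p
      rw [mk_preimage_prod_right_eq_if]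
      split_ifs <;> simp
    rw [this]
    exact Measurable.ite (measurable_fst hB) (M.measurable_q Γ hΓ) measurable_const
  | compl t ht ih =>
    have : (fun p : S × A => M.q p.1 p.2 (Prod.mk p.1 ⁻¹' tᶜ))
        = fun p => M.q p.1 p.2 univ - M.q p.1 p.2 (Prod.mk p.1 ⁻¹' t) := by
      ext p
      have h := VectorMeasure.of_add_of_sdiff (v := M.q p.1 p.2)
        (measurable_prodMk_left (x := p.1) ht) MeasurableSet.univ (subset_univ _)
      rw [preimage_compl, compl_eq_univ_sdiff]
      linarith
    rw [this]
    exact (M.measurable_q _ MeasurableSet.univ).sub ih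
  | iUnion f hd hm ih =>
    have h : ∀ p : S × A, HasSum (fun i => M.q p.1 p.2 (Prod.mk p.1 ⁻¹' f i))
        (M.q p.1 p.2 (Prod.mk p.1 ⁻¹' ⋃ i, f i)) := by
      intro p
      rw [preimage_iUnion]
      exact VectorMeasure.hasSum_of_disjoint_iUnion
        (fun i => measurable_prodMk_left (hm i)) fun i j hij => (hd hij).preimage _
    refine measurable_of_tendsto_metrizable (f := fun n (p : S × A) =>
      ∑ i ∈ Finset.range n, M.q p.1 p.2 (Prod.mk p.1 ⁻¹' f i))
      (fun n => Finset.measurable_sum _ fun i _ => ih i) ?_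
    exact tendsto_pi_nhds.2 fun p => (h p).tendsto_sum_nat

variable [StandardBorelSpace S]

/-- The measure `Γ ↦ q(Γ \ {x} | x, a)`. -/
def jump (x : S) (a : A) : Measure S :=
  (M.q x a).toMeasureOfZeroLE {x}ᶜ (measurableSet_singleton x).compl (M.zero_le_restrict_q x a)

theorem jump_apply (x : S) (a : A) {Γ : Set S} (hΓ : MeasurableSet Γ) :
    M.jump x a Γ = ENNReal.ofReal (M.q x a ({x}ᶜ ∩ Γ)) := by
  have := SignedMeasure.toMeasureOfZeroLE_real_apply (M.q x a) (M.zero_le_restrict_q x a)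
    (measurableSet_singleton x).compl hΓ
  rw [← this, measureReal_def, ENNReal.ofReal_toReal]
  · rfl
  · exact measure_ne_top _ _

theorem measurable_jump : Measurable fun p : S × A => M.jump p.1 p.2 := by
  refine Measure.measurable_of_measurable_coe _ fun Γ hΓ => ?_
  simp_rw [M.jump_apply _ _ hΓ]
  have hD : MeasurableSet ({p : S × S | p.2 ≠ p.1} ∩ univ ×ˢ Γ) :=
    ((measurableSet_eq_fun measurable_snd measurable_fst).compl).inter
      (MeasurableSet.univ.prod hΓ)
  refine ENNReal.measurable_ofReal.comp ?_
  convert M.measurable_q_section hD using 4 with p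
  ext y
  simp

theorem jump_univ_le (x : S) (a : A) : M.jump x a univ ≤ ENNReal.ofReal (M.maxRate x) := by
  rw [M.jump_apply _ _ MeasurableSet.univ, inter_univ]
  by_cases h : (x, a) ∈ M.K
  · refine ENNReal.ofReal_le_ofReal ?_
    have h1 := VectorMeasure.of_add_of_sdiff (v := M.q x a)
      (measurableSet_singleton x) MeasurableSet.univ (subset_univ _)
    rw [M.conservative x a h, ← compl_eq_univ_sdiff] at h1
    have h2 : M.rate x a ≤ M.maxRate x := le_csSup (M.stable x) ⟨a, h, rfl⟩
    simp only [rate] at h2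
    linarith
  · simp [M.q_eq_zero x a h]

/-- `jump`, extended by the zero measure to `x_∞` and `a_∞`. -/
def jumpExt : Adjoin S → Adjoin A → Measure S
  | Sum.inl x, Sum.inl a => M.jump x a
  | _, _ => 0

theorem measurable_jumpExt : Measurable fun p : Adjoin S × Adjoin A => M.jumpExt p.1 p.2 := by
  have he : MeasurableEmbedding (Prod.map Sum.inl Sum.inl : S × A → Adjoin S × Adjoin A) :=
    MeasurableEmbedding.prodMap ⟨Sum.inl_injective, measurable_inl, fun _ h => h.inl_image⟩
      ⟨Sum.inl_injective, measurable_inl, fun _ h => h.inl_image⟩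
  have : (fun p : Adjoin S × Adjoin A => M.jumpExt p.1 p.2)
      = Function.extend (Prod.map Sum.inl Sum.inl) (fun p : S × A => M.jump p.1 p.2)
        fun _ => 0 := by
    ext1 p
    rcases p with ⟨x | x, a | a⟩
    · exact (he.injective.extend_apply (fun p : S × A => M.jump p.1 p.2) (fun _ => 0) (x, a)).symm
    all_goals
      rw [Function.extend_apply']
      · rfl
      · rintro ⟨⟨y, b⟩, hyb⟩
        simp at hyb
  rw [this]
  exact he.measurable_extend M.measurable_jump measurable_const

end Model

/-! ### The canonical space of the controlled process -/

section Paths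

variable (S : Type*)

/-- A pair `(θ_n, x_n)` of a sojourn time and the subsequent state. -/
abbrev Mark := ℝ≥0∞ × Adjoin S

/-- The pair `(∞, x_∞)`. -/
def cemetery : Mark S := (∞, Sum.inr ())

variable {S}

/-- The sequences `(x_0, θ_1, x_1, θ_2, x_2, …)` with `x_0 ∈ S` such that either all `θ_n` lie in
`(0, ∞)` and all `x_n` in `S`, or this is so up to some index and all later pairs `(θ_n, x_n)` are
`(∞, x_∞)`. For uniformity the sequence starts with a dummy `θ_0 = 0`. -/
structure IsPath (ω : ℕ → Mark S) : Prop where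
  zero : (ω 0).1 = 0 ∧ (ω 0).2 ∈ range Sum.inl
  succ : ∀ n, ((ω (n + 1)).1 ∈ Ioo 0 ∞ ∧ (ω (n + 1)).2 ∈ range Sum.inl) ∨
    ω (n + 1) = cemetery S
  absorb : ∀ n, ω n = cemetery S → ω (n + 1) = cemetery S

variable (S) in
/-- The sample space `Ω`. -/
abbrev PathSpace := {ω : ℕ → Mark S // IsPath ω}

namespace PathSpace

/-- The state `x_m` after the `m`-th jump. -/
def state (m : ℕ) (ω : PathSpace S) : Adjoin S := (ω.1 m).2

/-- The jump moment `T_m = θ_1 + ⋯ + θ_m`. -/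
def jumpTime (m : ℕ) (ω : PathSpace S) : ℝ≥0∞ := ∑ i ∈ Finset.range (m + 1), (ω.1 i).1

open Classical in
/-- The process `ξ_t`: it is `x_m` on `T_m ≤ t < T_{m+1}`, and `x_∞` from `T_∞ = lim T_m` on. -/
def process (t : ℝ≥0) (ω : PathSpace S) : Adjoin S :=
  if h : ∃ m, jumpTime m ω ≤ t ∧ t < jumpTime (m + 1) ω then state (Nat.find h) ω
  else Sum.inr ()

open Classical in
/-- The process `ξ_{t-}`: it is `x_m` on `T_m < t ≤ T_{m+1}`, it is `x_0` at `t = 0`, and `x_∞`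
from `T_∞` on. -/
def leftProcess (t : ℝ≥0) (ω : PathSpace S) : Adjoin S :=
  if t = 0 then state 0 ω
  else if h : ∃ m, jumpTime m ω < t ∧ t ≤ jumpTime (m + 1) ω then state (Nat.find h) ω
  else Sum.inr ()

variable [MeasurableSpace S]

theorem measurable_state (m : ℕ) : Measurable (state m : PathSpace S → Adjoin S) :=
  measurable_snd.comp ((measurable_pi_apply m).comp measurable_subtype_coe)

theorem measurable_jumpTime (m : ℕ) : Measurable (jumpTime m : PathSpace S → ℝ≥0∞) :=
  Finset.measurable_sum _ fun i _ =>
    measurable_fst.comp ((measurable_pi_apply i).comp measurable_subtype_coe)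

variable (S) in
/-- The filtration `F_t = σ({T_m ≤ s, x_m ∈ Γ} : Γ ∈ B(S), s ≤ t, m ≥ 0)`. -/
def filtration : Filtration ℝ≥0 (inferInstance : MeasurableSpace (PathSpace S)) where
  seq t := MeasurableSpace.generateFrom {B | ∃ (m : ℕ) (s : ℝ≥0) (Γ : Set S), s ≤ t ∧
    MeasurableSet Γ ∧ B = {ω | jumpTime m ω ≤ s ∧ state m ω ∈ Sum.inl '' Γ}}
  mono' := by
    intro t t' htt'
    refine MeasurableSpace.generateFrom_mono ?_
    rintro B ⟨m, s, Γ, hs, hΓ, rfl⟩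
    exact ⟨m, s, Γ, hs.trans htt', hΓ, rfl⟩
  le' := by
    intro t
    refine MeasurableSpace.generateFrom_le ?_
    rintro B ⟨m, s, Γ, -, hΓ, rfl⟩
    exact (measurableSet_le (measurable_jumpTime m) measurable_const).inter
      (measurable_state m hΓ.inl_image)

variable (S) in
theorem predictable_le :
    (filtration S).predictable ≤ (inferInstance : MeasurableSpace (ℝ≥0 × PathSpace S)) :=
  measurableSpace_le_predictable_of_measurableSet
    (fun _ h => (measurableSet_singleton _).prod ((filtration S).le _ _ h))
    (fun _ _ h => measurableSet_Ioi.prod ((filtration S).le _ _ h))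

end PathSpace

/-- The histories `(θ_0, x_0, θ_1, x_1, …, θ_k, x_k)`, where `θ_0 = 0` is the dummy. -/
abbrev Hist (S : Type*) (k : ℕ) := (i : Finset.Iic k) → Mark S

/-- The sequence `(x_0, θ_1, x_1, …, θ_k, x_k, ∞, x_∞, ∞, x_∞, …)`. -/
def Hist.extend {k : ℕ} (h : Hist S k) : ℕ → Mark S :=
  fun n => if hn : n ≤ k then h ⟨n, Finset.mem_Iic.2 hn⟩ else cemetery S

/-- The last state `x_k` of a history. -/
def Hist.last {k : ℕ} (h : Hist S k) : Adjoin S := (h ⟨k, Finset.mem_Iic.2 le_rfl⟩).2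

theorem Hist.measurable_extend [MeasurableSpace S] (k : ℕ) :
    Measurable (Hist.extend : Hist S k → ℕ → Mark S) := by
  refine measurable_pi_lambda _ fun n => ?_
  unfold Hist.extend
  split_ifs with hn
  · exact measurable_pi_apply _
  · exact measurable_const

theorem Hist.measurable_last [MeasurableSpace S] (k : ℕ) :
    Measurable (Hist.last : Hist S k → Adjoin S) :=
  measurable_snd.comp (measurable_pi_apply _)

theorem measurableSet_isPath [MeasurableSpace S] : MeasurableSet {ω : ℕ → Mark S | IsPath ω} := by
  have hc : ∀ n, MeasurableSet {ω : ℕ → Mark S | ω n = cemetery S} := by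
    intro n
    have h1 : MeasurableSet {p : Mark S | p = cemetery S} := by
      convert (measurableSet_singleton (∞ : ℝ≥0∞)).prod
        (measurableSet_range_inr : MeasurableSet (range Sum.inr : Set (Adjoin S))) using 1
      ext ⟨t, x⟩
      rcases x with x | x <;> simp [cemetery]
    exact (measurable_pi_apply (X := fun _ : ℕ => Mark S) n) h1
  have h2 : ∀ n, MeasurableSet {ω : ℕ → Mark S | (ω n).2 ∈ range Sum.inl} := fun n =>
    (measurable_snd.comp (measurable_pi_apply n)) measurableSet_range_inl
  have h1 : ∀ n, Measurable fun ω : ℕ → Mark S => (ω n).1 := fun n =>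
    measurable_fst.comp (measurable_pi_apply n)
  have : {ω : ℕ → Mark S | IsPath ω} =
      ({ω | (ω 0).1 = 0} ∩ {ω | (ω 0).2 ∈ range Sum.inl}) ∩
      (⋂ n, ({ω | (ω (n + 1)).1 ∈ Ioo 0 ∞} ∩ {ω | (ω (n + 1)).2 ∈ range Sum.inl}) ∪
        {ω | ω (n + 1) = cemetery S}) ∩
      ⋂ n, ({ω | ω n = cemetery S}ᶜ ∪ {ω | ω (n + 1) = cemetery S}) := by
    ext ω
    simp only [mem_ofPred_eq, mem_inter_iff, mem_iInter, mem_union, mem_compl_iff,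
      ← imp_iff_not_or]
    exact ⟨fun h => ⟨⟨h.zero, h.succ⟩, h.absorb⟩, fun h => ⟨h.1.1, h.1.2, h.2⟩⟩
  rw [this]
  refine MeasurableSet.inter (MeasurableSet.inter ?_ ?_) ?_
  · exact (h1 0 (measurableSet_singleton 0)).inter (h2 0)
  · exact MeasurableSet.iInter fun n =>
      ((h1 (n + 1) measurableSet_Ioo).inter (h2 (n + 1))).union (hc (n + 1))
  · exact MeasurableSet.iInter fun n => (hc n).compl.union (hc (n + 1))

end Paths

/-! ### Policies and the law of the controlled process -/

variable {S A : Type*} [MeasurableSpace S] [MeasurableSpace A]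

/-- A randomized history-dependent policy `π(· | ω, t)`: a transition probability from
`Ω × [0, ∞)` with the predictable σ-algebra to `A ∪ {a_∞}`, concentrated on `A(ξ_{t-})`. -/
structure Policy (M : Model S A) where
  /-- the probability measure `π(· | ω, t)` -/
  prob : ℝ≥0 → PathSpace S → Measure (Adjoin A)
  isProbabilityMeasure : ∀ t ω, IsProbabilityMeasure (prob t ω)
  predictable : ∀ B, MeasurableSet B →
    Measurable[(PathSpace.filtration S).predictable] fun p : ℝ≥0 × PathSpace S => prob p.1 p.2 B
  concentrated : ∀ t ω, prob t ω (M.admExt (PathSpace.leftProcess t ω))ᶜ = 0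

namespace Policy

variable {M : Model S A} (π : Policy M)

theorem measurable_prob : Measurable fun p : ℝ≥0 × PathSpace S => π.prob p.1 p.2 :=
  Measure.measurable_of_measurable_coe _ fun B hB =>
    (π.predictable B hB).mono (PathSpace.predictable_le S) le_rfl

open Classical in
/-- `π(· | x_0, θ_1, …, θ_k, x_k, T_k + u)`: the action distribution at time `T_k + u` when the
`(k+1)`-st jump has not occurred before that time. By predictability it can be read off from the
path that has no further jump after the history `h`. (It is set to `0` on sequences which are not
histories of paths; these have probability zero.) -/
def histProb (k : ℕ) (h : Hist S k) (u : ℝ) : Measure (Adjoin A) :=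
  if hp : IsPath h.extend then
    π.prob ((PathSpace.jumpTime k ⟨h.extend, hp⟩).toNNReal + u.toNNReal) ⟨h.extend, hp⟩
  else 0

theorem measurable_histProb (k : ℕ) :
    Measurable fun p : Hist S k × ℝ => π.histProb k p.1 p.2 := by
  classical
  have hs : MeasurableSet {p : Hist S k × ℝ | IsPath p.1.extend} :=
    ((Hist.measurable_extend k).comp measurable_fst) measurableSet_isPath
  have hω : Measurable fun p : {p : Hist S k × ℝ | IsPath p.1.extend} =>
      (⟨p.1.1.extend, p.2⟩ : PathSpace S) :=
    (((Hist.measurable_extend k).comp measurable_fst).comp measurable_subtype_coe).subtype_mk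
  refine Measurable.dite (s := {p : Hist S k × ℝ | IsPath p.1.extend})
    (f := fun p => π.prob ((PathSpace.jumpTime k ⟨p.1.1.extend, p.2⟩).toNNReal
      + p.1.2.toNNReal) ⟨p.1.1.extend, p.2⟩) (g := fun _ => 0) ?_ measurable_const hs
  refine π.measurable_prob.comp (Measurable.prodMk ?_ hω)
  exact (((PathSpace.measurable_jumpTime k).comp hω).ennreal_toNNReal).add
    (measurable_snd.comp measurable_subtype_coe).real_toNNReal

theorem histProb_univ_le (k : ℕ) (h : Hist S k) (u : ℝ) : π.histProb k h u univ ≤ 1 := by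
  unfold histProb
  split_ifs
  · have := π.isProbabilityMeasure
    exact prob_le_one
  · simp

/-- `histProb` as a kernel. -/
def histKernel (k : ℕ) : Kernel (Hist S k × ℝ) (Adjoin A) where
  toFun p := π.histProb k p.1 p.2
  measurable' := π.measurable_histProb k

instance (k : ℕ) : IsFiniteKernel (π.histKernel k) :=
  ⟨⟨1, by simp, fun p => π.histProb_univ_le k p.1 p.2⟩⟩

variable [StandardBorelSpace S]

/-- The jump intensity given the history, the kernel
`Λ^k(Γ | x_0, θ_1, …, θ_k, x_k, u) = ∫_A π(da | x_0, θ_1, …, x_k, T_k + u) q(Γ \ {x_k} | x_k, a)`.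
It vanishes if `x_k = x_∞`, that is, if `θ_k = ∞`. -/
def intensity (k : ℕ) : Kernel (Hist S k × ℝ) S where
  toFun p := (π.histProb k p.1 p.2).bind fun a => M.jumpExt p.1.last a
  measurable' := by
    refine Measure.measurable_of_measurable_coe _ fun Γ hΓ => ?_
    have hm : Measurable fun p : (Hist S k × ℝ) × Adjoin A => M.jumpExt p.1.1.last p.2 :=
      M.measurable_jumpExt.comp
        (((Hist.measurable_last k).comp (measurable_fst.comp measurable_fst)).prodMk measurable_snd)
    have h1 : ∀ p : Hist S k × ℝ,
        ((π.histProb k p.1 p.2).bind fun a => M.jumpExt p.1.last a) Γ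
          = ∫⁻ a, M.jumpExt p.1.last a Γ ∂(π.histKernel k p) := fun p =>
      Measure.bind_apply hΓ (hm.comp measurable_prodMk_left).aemeasurable
    simp_rw [h1]
    exact Measurable.lintegral_kernel_prod_right' (κ := π.histKernel k)
      ((Measure.measurable_coe hΓ).comp hm)

/-- For a given history, the total jump intensity is bounded in time. -/
theorem intensity_bounded (k : ℕ) (h : Hist S k) :
    ∃ C : ℝ≥0, ∀ u, π.intensity k (h, u) univ ≤ C := by
  have hm : Measurable fun a => M.jumpExt h.last a :=
    M.measurable_jumpExt.comp measurable_prodMk_left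
  obtain ⟨C, hC⟩ : ∃ C : ℝ≥0, ∀ a, M.jumpExt h.last a univ ≤ C := by
    rcases h.last with x | x
    · refine ⟨(M.maxRate x).toNNReal, fun a => ?_⟩
      rcases a with a | a
      · exact M.jump_univ_le x a
      · simp [Model.jumpExt]
    · exact ⟨0, fun a => by simp [Model.jumpExt]⟩
  refine ⟨C, fun u => ?_⟩
  change ((π.histProb k h u).bind fun a => M.jumpExt h.last a) univ ≤ C
  rw [Measure.bind_apply MeasurableSet.univ hm.aemeasurable]
  calc ∫⁻ a, M.jumpExt h.last a univ ∂(π.histProb k h u)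
      ≤ ∫⁻ _, C ∂(π.histProb k h u) := lintegral_mono hC
    _ ≤ C := by
      rw [lintegral_const]
      exact mul_le_of_le_one_right zero_le (π.histProb_univ_le k h u)

instance (k : ℕ) : IsSFiniteKernel (π.intensity k) :=
  isSFiniteKernel_of_finite _ fun p => by
    obtain ⟨C, hC⟩ := π.intensity_bounded k p.1
    exact (hC p.2).trans_lt ENNReal.coe_lt_top

/-- `∫_{(0,u]} Λ^k(S | h, v) dv`. -/
def cumIntensity (k : ℕ) (h : Hist S k) (u : ℝ) : ℝ≥0∞ :=
  ∫⁻ v in Ioc 0 u, π.intensity k (h, v) univ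

/-- `∫_{(0,∞)} Λ^k(S | h, v) dv`. -/
def totalIntensity (k : ℕ) (h : Hist S k) : ℝ≥0∞ :=
  ∫⁻ v in Ioi 0, π.intensity k (h, v) univ

theorem measurable_cumIntensity (k : ℕ) :
    Measurable fun p : Hist S k × ℝ => π.cumIntensity k p.1 p.2 := by
  have h1 : (fun p : Hist S k × ℝ => π.cumIntensity k p.1 p.2) = fun p =>
      ∫⁻ v, {z : (Hist S k × ℝ) × ℝ | 0 < z.2 ∧ z.2 ≤ z.1.2}.indicator
        (fun z => π.intensity k (z.1.1, z.2) univ) (p, v) := by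
    ext p
    rw [cumIntensity, ← lintegral_indicator measurableSet_Ioc]
    rfl
  rw [h1]
  refine Measurable.lintegral_prod_right' (Measurable.indicator ?_ ?_)
  · exact ((π.intensity k).measurable_coe MeasurableSet.univ).comp
      ((measurable_fst.comp measurable_fst).prodMk measurable_snd)
  · exact (measurableSet_lt measurable_const measurable_snd).inter
      (measurableSet_le measurable_snd (measurable_snd.comp measurable_fst))

theorem measurable_totalIntensity (k : ℕ) : Measurable (π.totalIntensity k) :=
  ((π.intensity k).measurable_coe MeasurableSet.univ).lintegral_prod_right'

/-- The conditional law of `(θ_{k+1}, x_{k+1})` given the history `h = (x_0, θ_1, …, θ_k, x_k)`: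
on `(0, ∞) × S` it is `Λ^k(dy | h, u) e^{-∫_0^u Λ^k(S | h, v) dv} du`, and the mass of
`(∞, x_∞)` is `e^{-∫_0^∞ Λ^k(S | h, v) dv}`. If `θ_k = ∞` then `Λ^k = 0`, so that this is the
point mass at `(∞, x_∞)`. -/
def stepKernel (k : ℕ) : Kernel (Hist S k) (Mark S) :=
  ((Kernel.const (Hist S k) (volume.restrict (Ioi (0 : ℝ))) ⊗ₖ π.intensity k).withDensity
      (fun h p => expNeg (π.cumIntensity k h p.1))).map
    (fun p => (ENNReal.ofReal p.1, Sum.inl p.2)) +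
  (Kernel.const (Hist S k) (Measure.dirac (cemetery S))).withDensity
    (fun h _ => expNeg (π.totalIntensity k h))

instance (k : ℕ) : IsMarkovKernel (π.stepKernel k) := by
  refine ⟨fun h => ⟨?_⟩⟩
  obtain ⟨C, hC⟩ := π.intensity_bounded k h
  have hmap : Measurable fun p : ℝ × S => ((ENNReal.ofReal p.1, Sum.inl p.2) : Mark S) :=
    (ENNReal.measurable_ofReal.comp measurable_fst).prodMk (measurable_inl.comp measurable_snd)
  have hd : Measurable (Function.uncurry fun (h : Hist S k) (p : ℝ × S) =>
      expNeg (π.cumIntensity k h p.1)) :=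
    measurable_expNeg.comp ((π.measurable_cumIntensity k).comp
      (measurable_fst.prodMk (measurable_fst.comp measurable_snd)))
  have hd2 : Measurable (Function.uncurry fun (h : Hist S k) (_ : Mark S) =>
      expNeg (π.totalIntensity k h)) :=
    measurable_expNeg.comp ((π.measurable_totalIntensity k).comp measurable_fst)
  have hg : Measurable fun v : ℝ => π.intensity k (h, v) univ :=
    ((π.intensity k).measurable_coe MeasurableSet.univ).comp measurable_prodMk_left
  rw [stepKernel, _root_.add_apply, Measure.add_apply, Kernel.map_apply' _ hmap _ MeasurableSet.univ,
    preimage_univ, Kernel.withDensity_apply' _ hd, Kernel.withDensity_apply' _ hd2,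
    setLIntegral_univ, setLIntegral_univ, Kernel.lintegral_compProd _ _ _
      (f := fun p => expNeg (π.cumIntensity k h p.1)) (hd.comp measurable_prodMk_left)]
  rw [← lintegral_hazard hg hC]
  simp only [Kernel.const_apply, lintegral_const, measure_univ, mul_one]
  rfl

/-- The probability measure `P_γ^π` on `Ω`: the law, given by the Ionescu-Tulcea theorem, of the
sequence `(θ_0, x_0), (θ_1, x_1), …` with `θ_0 = 0`, `x_0 ∼ γ` and the conditional laws
`stepKernel`. It is concentrated on the set of paths, and hence a measure on `Ω`. -/
def law (γ : Measure S) : Measure (PathSpace S) :=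
  (Kernel.trajMeasure (X := fun _ => Mark S) (γ.map fun x => ((0, Sum.inl x) : Mark S))
    π.stepKernel).comap Subtype.val

/-- `P_x^π`. -/
def lawFrom (x : S) : Measure (PathSpace S) := π.law (Measure.dirac x)

end Policy

/-! ### The conditions and the terms of the formulas -/

namespace Model

variable (M : Model S A)

/-- A measurable function `f` satisfies `∫_S q(dy | x, a) f(y) ≤ ρ f(x) + b` for all `x ∈ S` and
`a ∈ A(x)`; the integral is finite. -/
def DriftBound (f : S → ℝ) (ρ b : ℝ) : Prop :=
  ∀ x, ∀ a ∈ M.adm x, (M.q x a).Integrable f ∧ ∫ᵛ y, f y ∂<•(M.q x a) ≤ ρ * f x + b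

/-- The Lyapunov condition on the weight function `w`. -/
structure IsLyapunov (w : S → ℝ) : Prop where
  measurable : Measurable w
  one_le : ∀ x, 1 ≤ w x
  exists_bounds : ∃ ρ b : ℝ, ∃ Sl : ℕ → Set S, 0 ≤ ρ ∧ 0 ≤ b ∧
    (∀ l, MeasurableSet (Sl l)) ∧ Monotone Sl ∧ ⋃ l, Sl l = univ ∧
    Tendsto (fun l => ⨅ x ∈ (Sl l)ᶜ, (w x : EReal)) atTop (𝓝 ⊤) ∧
    M.DriftBound w ρ b ∧
    ∀ l, BddAbove (M.maxRate '' Sl l)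

/-- The condition on the second weight function `w'`, given the first one, `w`. -/
structure IsSecondWeight (w w' : S → ℝ) : Prop where
  measurable : Measurable w'
  one_le : ∀ x, 1 ≤ w' x
  exists_bounds : ∃ L ρ b : ℝ, 0 ≤ L ∧ 0 ≤ ρ ∧ 0 ≤ b ∧
    (∀ x, (M.maxRate x + 1) * w' x ≤ L * w x) ∧
    M.DriftBound w' ρ b

/-- `∫_S q(dy | x, a) u(y)` as a function of `x` and `a`, extended by zero to `x_∞` and `a_∞`. -/
def generator (u : S → ℝ) : Adjoin S → Adjoin A → ℝ
  | Sum.inl x, Sum.inl a => ∫ᵛ y, u y ∂<•(M.q x a)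
  | _, _ => 0

end Model

/-- The space `B_w(S)` of measurable functions with finite `w`-weighted norm. -/
def WeightedBounded (w u : S → ℝ) : Prop :=
  Measurable u ∧ BddAbove (range fun x => |u x| / w x)

/-- A function on `S`, extended by zero to `x_∞`. -/
def extendZero (u : S → ℝ) : Adjoin S → ℝ := Sum.elim u fun _ => 0

/-- `∫_A π(da | ω, v) ∫_S q(dy | ξ_v, a) u(y)`. -/
def Policy.drift {M : Model S A} (π : Policy M) (u : S → ℝ) (v : ℝ≥0) (ω : PathSpace S) : ℝ :=
  ∫ a, M.generator u (PathSpace.process v ω) a ∂(π.prob v ω)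

end CTMDP

end

open CTMDP

/-!
Given the first `k` jumps, the next holding time and post-jump state are governed by a hazard
measure on `S`; integrating the resulting density against the survival function shows that jumps
are compensated by the jump rates: the expected sum of `G(x_k, x_{k+1})` over the jumps up to time
`t` equals the expected time integral over `[0, t]` of the rate at which such jumps occur.

If `W` grows at rate at most `c` under the jump intensities, then `exp(-c T_k) W(x_k)` is a
supermartingale, because discounting acts as an additional hazard rate. This bounds the expectation
of `W(ξ_t)`. It also excludes explosion: the expected weight at each jump before `t` is bounded,
so by Fatou's lemma an explosive path would return infinitely often to some sublevel set of `w`,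
whereas the rates are bounded there and only finitely many jumps out of it occur by time `t`.

Telescoping `f(x_{k+1}) - f(x_k)` over the jumps and applying the compensator identity to the
positive and negative increments gives Dynkin's formula for nonnegative `f`, as an equality of sums
of extended nonnegative integrals. A `w'`-bounded `u` is a difference of two such functions, with
integrability supplied by the growth bounds on `w` and `w'`. The discounted formula follows from
the undiscounted one by integration by parts in time.
-/

noncomputable section

namespace CTMDP

section Hazard

theorem expNeg_add (a b : ℝ≥0∞) : expNeg (a + b) = expNeg a * expNeg b := by
  rw [expNeg, expNeg, expNeg, ← EReal.exp_add, EReal.coe_ennreal_add,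
    EReal.neg_add (Or.inl (by simp)) (Or.inr (by simp)), sub_eq_add_neg]

theorem expNeg_zero : expNeg 0 = 1 := by
  simp [expNeg]

theorem expNeg_anti : Antitone expNeg := fun _ _ h =>
  EReal.exp_monotone (EReal.neg_le_neg_iff.2 (EReal.coe_ennreal_le_coe_ennreal_iff.2 h))

theorem expNeg_ne_zero {r : ℝ≥0∞} (hr : r ≠ ∞) : expNeg r ≠ 0 := by
  simpa [expNeg] using hr

theorem lintegral_hazard_Ioc {g : ℝ → ℝ≥0∞} (hg : Measurable g) {C : ℝ≥0} (hC : ∀ v, g v ≤ C)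
    (T : ℝ) :
    (∫⁻ u in Ioc (0 : ℝ) T, expNeg (∫⁻ v in Ioc 0 u, g v) * g u)
      + expNeg (∫⁻ v in Ioc (0 : ℝ) T, g v) = 1 := by
  have hI : Iic T ∩ Ioi (0 : ℝ) = Ioc 0 T := by rw [inter_comm, Ioi_inter_Iic]
  have htrunc : ∀ u, expNeg (∫⁻ v in Ioc 0 u, (Iic T).indicator g v) * (Iic T).indicator g u
      = (Iic T).indicator (fun u => expNeg (∫⁻ v in Ioc 0 u, g v) * g u) u := by
    intro u
    by_cases hu : u ∈ Iic T
    · have hgu : ∫⁻ v in Ioc 0 u, (Iic T).indicator g v = ∫⁻ v in Ioc 0 u, g v :=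
        setLIntegral_congr_fun measurableSet_Ioc fun v hv =>
          indicator_of_mem (mem_Iic.2 (hv.2.trans hu)) g
      rw [indicator_of_mem hu, indicator_of_mem hu, hgu]
    · rw [indicator_of_notMem hu, indicator_of_notMem hu, mul_zero]
  have h := lintegral_hazard (g := (Iic T).indicator g) (hg.indicator measurableSet_Iic) (C := C)
    fun v => (indicator_le_self _ _ v).trans (hC v)
  simp only [htrunc] at h
  simpa only [setLIntegral_indicator measurableSet_Iic, hI] using h

end Hazard

section ZeroExtension

variable {S : Type*}

/-- A function on `S` as a `[0, ∞]`-valued function on `S ∪ {x_∞}`, zero at `x_∞`. Negative values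
are truncated to `0`. -/
def ennExt (f : S → ℝ) : Adjoin S → ℝ≥0∞ :=
  Sum.elim (fun x => ENNReal.ofReal (f x)) fun _ => 0

@[simp]
theorem ennExt_inl (f : S → ℝ) (x : S) : ennExt f (Sum.inl x) = ENNReal.ofReal (f x) :=
  rfl

@[simp]
theorem ennExt_inr (f : S → ℝ) (x : Unit) : ennExt f (Sum.inr x) = 0 :=
  rfl

theorem ennExt_ne_top (f : S → ℝ) (z : Adjoin S) : ennExt f z ≠ ∞ := by
  rcases z with _ | _ <;> simp

theorem enorm_extendZero (u : S → ℝ) (z : Adjoin S) :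
    ‖extendZero u z‖ₑ = ennExt (fun x => |u x|) z := by
  rcases z with x | x <;> simp [extendZero, Real.enorm_eq_ofReal_abs]

theorem toReal_ennExt {u : S → ℝ} (hu : ∀ x, 0 ≤ u x) (z : Adjoin S) :
    (ennExt u z).toReal = extendZero u z := by
  rcases z with _ | _ <;> simp [extendZero, hu]

theorem extendZero_sub (u v : S → ℝ) (z : Adjoin S) :
    extendZero (u - v) z = extendZero u z - extendZero v z := by
  rcases z with x | x <;> simp [extendZero]

variable [MeasurableSpace S]

theorem measurable_ennExt {f : S → ℝ} (hf : Measurable f) : Measurable (ennExt f) :=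
  hf.ennreal_ofReal.sumElim measurable_const

theorem measurable_extendZero {u : S → ℝ} (hu : Measurable u) : Measurable (extendZero u) :=
  hu.sumElim measurable_const

end ZeroExtension

namespace WeightedBounded

variable {S : Type*} [MeasurableSpace S] {w u v : S → ℝ}

theorem abs (h : WeightedBounded w u) : WeightedBounded w fun x => |u x| :=
  ⟨h.1.abs, by simpa using h.2⟩

theorem of_abs_le (hw : ∀ x, 1 ≤ w x) (hu : WeightedBounded w u) (hv : Measurable v)
    (hvu : ∀ x, |v x| ≤ |u x|) : WeightedBounded w v := by
  refine ⟨hv, hu.2.range_mono _ fun x => ?_⟩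
  exact div_le_div_of_nonneg_right (hvu x) (zero_le_one.trans (hw x))

theorem exists_ennExt_le (hw : ∀ x, 1 ≤ w x) (h : WeightedBounded w u) :
    ∃ C : ℝ≥0, ∀ z, ennExt u z ≤ C * ennExt w z := by
  obtain ⟨C, hC⟩ := h.2
  refine ⟨C.toNNReal, ?_⟩
  rintro (x | x)
  · have hx : 0 < w x := zero_lt_one.trans_le (hw x)
    have hux : |u x| ≤ C.toNNReal * w x :=
      ((div_le_iff₀ hx).1 (hC ⟨x, rfl⟩)).trans (by gcongr; exact Real.le_coe_toNNReal C)
    rw [ennExt_inl, ennExt_inl, ← ENNReal.ofReal_coe_nnreal, ← ENNReal.ofReal_mul (by positivity)]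
    exact ENNReal.ofReal_le_ofReal ((le_abs_self _).trans hux)
  · simp

theorem induction_sub {P : (S → ℝ) → Prop} (hw : ∀ x, 1 ≤ w x) (hu : WeightedBounded w u)
    (nonneg : ∀ v, WeightedBounded w v → (∀ x, 0 ≤ v x) → P v)
    (sub : ∀ v₁ v₂, WeightedBounded w v₁ → WeightedBounded w v₂ → P v₁ → P v₂ → P (v₁ - v₂)) :
    P u := by
  have hpos : WeightedBounded w fun x => max (u x) 0 :=
    hu.of_abs_le hw (hu.1.max measurable_const) fun x => by
      rw [abs_of_nonneg (le_max_right _ _)]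
      exact max_le (le_abs_self _) (abs_nonneg _)
  have hneg : WeightedBounded w fun x => max (-u x) 0 :=
    hu.of_abs_le hw (hu.1.neg.max measurable_const) fun x => by
      rw [abs_of_nonneg (le_max_right _ _)]
      exact max_le (neg_le_abs _) (abs_nonneg _)
  have hu_eq : (fun x => max (u x) 0) - (fun x => max (-u x) 0) = u :=
    funext fun x => max_zero_sub_eq_self (u x)
  rw [← hu_eq]
  exact sub _ _ hpos hneg (nonneg _ hpos fun x => le_max_right _ _)
    (nonneg _ hneg fun x => le_max_right _ _)

end WeightedBounded

section SignedMeasure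

variable {X : Type*} [MeasurableSpace X]

theorem integrable_toSignedMeasure_iff {μ : Measure X} [IsFiniteMeasure μ] {f : X → ℝ} :
    μ.toSignedMeasure.Integrable f ↔ Integrable f μ := by
  rw [VectorMeasure.Integrable, Measure.variation_toSignedMeasure]

theorem integrable_vectorMeasure_dirac [MeasurableSingletonClass X] (x : X) (c : ℝ) (f : X → ℝ) :
    (VectorMeasure.dirac x c).Integrable f := by
  rw [VectorMeasure.Integrable, VectorMeasure.variation_dirac]
  exact (integrable_dirac (by simp)).smul_measure (by simp)

end SignedMeasure

namespace Model

variable {S A : Type*} [MeasurableSpace S] [MeasurableSpace A] [StandardBorelSpace S]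
  (M : Model S A)

theorem q_compl_singleton (x : S) (a : A) : M.q x a {x}ᶜ = M.rate x a := by
  by_cases h : (x, a) ∈ M.K
  · have hadd := VectorMeasure.of_add_of_sdiff (v := M.q x a)
      (measurableSet_singleton x) MeasurableSet.univ (subset_univ _)
    rw [M.conservative x a h, ← compl_eq_univ_sdiff] at hadd
    rw [rate]
    linarith
  · simp [rate, M.q_eq_zero x a h]

theorem q_inter_compl_nonneg (x : S) (a : A) {Γ : Set S} (hΓ : MeasurableSet Γ) :
    0 ≤ M.q x a ({x}ᶜ ∩ Γ) := by
  by_cases h : (x, a) ∈ M.K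
  · exact M.q_nonneg x a h _ ((measurableSet_singleton x).compl.inter hΓ) (by simp)
  · simp [M.q_eq_zero x a h]

theorem rate_nonneg (x : S) (a : A) : 0 ≤ M.rate x a := by
  simpa [q_compl_singleton] using M.q_inter_compl_nonneg x a MeasurableSet.univ

theorem maxRate_nonneg (x : S) : 0 ≤ M.maxRate x := by
  obtain ⟨φ, -, hφ⟩ := M.exists_selector
  exact (M.rate_nonneg x (φ x)).trans (le_csSup (M.stable x) ⟨φ x, hφ x, rfl⟩)

instance isFiniteMeasure_jump (x : S) (a : A) : IsFiniteMeasure (M.jump x a) :=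
  ⟨(M.jump_univ_le x a).trans_lt ENNReal.ofReal_lt_top⟩

theorem jump_univ (x : S) (a : A) : M.jump x a univ = ENNReal.ofReal (M.rate x a) := by
  rw [M.jump_apply x a MeasurableSet.univ, inter_univ, q_compl_singleton]

theorem jump_eq_zero {x : S} {a : A} (h : a ∉ M.adm x) : M.jump x a = 0 := by
  rw [← Measure.measure_univ_eq_zero, jump_univ, rate, M.q_eq_zero x a h]
  simp

theorem q_eq_jump_add_dirac (x : S) (a : A) :
    M.q x a = (M.jump x a).toSignedMeasure + VectorMeasure.dirac x (M.q x a {x}) := by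
  ext Γ hΓ
  have hsplit := VectorMeasure.of_union (v := M.q x a) (A := {x}ᶜ ∩ Γ) (B := {x} ∩ Γ)
    (disjoint_compl_left.mono inter_subset_left inter_subset_left)
    ((measurableSet_singleton x).compl.inter hΓ) ((measurableSet_singleton x).inter hΓ)
  rw [← union_inter_distrib_right, compl_union_self, univ_inter] at hsplit
  rw [_root_.add_apply, Measure.toSignedMeasure_apply_measurable hΓ, measureReal_def,
    M.jump_apply x a hΓ, ENNReal.toReal_ofReal (M.q_inter_compl_nonneg x a hΓ), hsplit]
  by_cases hx : x ∈ Γ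
  · rw [VectorMeasure.dirac_apply_of_mem hΓ hx, inter_eq_left.2 (singleton_subset_iff.2 hx)]
  · rw [VectorMeasure.dirac_apply_of_notMem hx, singleton_inter_eq_empty.2 hx]
    simp

theorem jump_le_variation (x : S) (a : A) : M.jump x a ≤ (M.q x a).variation := by
  refine Measure.le_iff.2 fun Γ hΓ => ?_
  rw [M.jump_apply x a hΓ, ← Real.enorm_of_nonneg (M.q_inter_compl_nonneg x a hΓ)]
  exact (VectorMeasure.enorm_measure_le_variation _ _).trans (measure_mono inter_subset_right)

theorem integrable_q_iff {x : S} {a : A} {f : S → ℝ} :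
    (M.q x a).Integrable f ↔ Integrable f (M.jump x a) := by
  refine ⟨fun h => h.mono_measure (M.jump_le_variation x a), fun h => ?_⟩
  rw [M.q_eq_jump_add_dirac x a]
  exact (integrable_toSignedMeasure_iff.2 h).add_vectorMeasure
    (integrable_vectorMeasure_dirac _ _ _)

theorem integral_q {x : S} {a : A} {f : S → ℝ} (h : Integrable f (M.jump x a)) :
    ∫ᵛ y, f y ∂<•(M.q x a) = ∫ y, f y ∂(M.jump x a) - M.rate x a * f x := by
  rw [M.q_eq_jump_add_dirac x a, VectorMeasure.integral_add_vectorMeasure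
    (integrable_toSignedMeasure_iff.2 h) (integrable_vectorMeasure_dirac _ _ _),
    VectorMeasure.integral_toSignedMeasure, VectorMeasure.integral_dirac]
  simp [rate]

theorem jumpExt_univ_le (z : Adjoin S) (a : Adjoin A) :
    M.jumpExt z a univ ≤ ennExt M.maxRate z := by
  rcases z with x | _ <;> rcases a with a | _
  · exact M.jump_univ_le x a
  all_goals simp [jumpExt]

instance isFiniteMeasure_jumpExt (z : Adjoin S) (a : Adjoin A) : IsFiniteMeasure (M.jumpExt z a) :=
  ⟨(M.jumpExt_univ_le z a).trans_lt (ennExt_ne_top _ z).lt_top⟩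

/-- `jumpExt` as a kernel. -/
def jumpKernel : Kernel (Adjoin S × Adjoin A) S where
  toFun p := M.jumpExt p.1 p.2
  measurable' := M.measurable_jumpExt

instance : IsSFiniteKernel M.jumpKernel :=
  isSFiniteKernel_of_finite _ fun p => measure_lt_top (M.jumpExt p.1 p.2) univ

theorem measurable_lintegral_jumpExt {G : Adjoin S × Adjoin S → ℝ≥0∞} (hG : Measurable G) :
    Measurable fun p : Adjoin S × Adjoin A => ∫⁻ y, G (p.1, Sum.inl y) ∂(M.jumpExt p.1 p.2) :=
  Measurable.lintegral_kernel_prod_right' (κ := M.jumpKernel)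
    (f := fun z => G (z.1.1, Sum.inl z.2))
    (hG.comp ((measurable_fst.comp measurable_fst).prodMk (measurable_inl.comp measurable_snd)))

/-- The drift condition `∫ q(dy | z, a) W(y) ≤ c W(z)`, with the negative part of `q` moved to the
right-hand side so that it makes sense for `[0, ∞]`-valued `W`. -/
def GrowthBound (W : Adjoin S → ℝ≥0∞) (c : ℝ≥0) : Prop :=
  ∀ z a, ∫⁻ y, W (Sum.inl y) ∂(M.jumpExt z a) ≤ (M.jumpExt z a univ + c) * W z

/-- The rate at which a functional `G(ξ_{s-}, ξ_s)` of the jumps accumulates is at most a constant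
multiple of `W(ξ_{s-})`, whatever the action. -/
def JumpBounded (G : Adjoin S × Adjoin S → ℝ≥0∞) (W : Adjoin S → ℝ≥0∞) : Prop :=
  ∃ K : ℝ≥0, ∀ z a, ∫⁻ y, G (z, Sum.inl y) ∂(M.jumpExt z a) ≤ K * W z

variable {M}

theorem DriftBound.growthBound {f : S → ℝ} {ρ b : ℝ} (hf : ∀ x, 1 ≤ f x) (hb : 0 ≤ b)
    (h : M.DriftBound f ρ b) : M.GrowthBound (ennExt f) (ρ + b).toNNReal := by
  rintro (x | x) (a | a)
  · by_cases ha : a ∈ M.adm x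
    · obtain ⟨hint, hle⟩ := h x a ha
      rw [integrable_q_iff] at hint
      rw [M.integral_q hint] at hle
      have hc : ρ + b ≤ ((ρ + b).toNNReal : ℝ) := Real.le_coe_toNNReal _
      have hf0 : ∀ y, 0 ≤ f y := fun y => zero_le_one.trans (hf y)
      have hr := M.rate_nonneg x a
      simp only [jumpExt, ennExt_inl]
      rw [← ofReal_integral_eq_lintegral_ofReal hint (ae_of_all _ hf0), M.jump_univ,
        ← ENNReal.ofReal_coe_nnreal, ← ENNReal.ofReal_add hr (by positivity),
        ← ENNReal.ofReal_mul (by positivity)]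
      exact ENNReal.ofReal_le_ofReal (by nlinarith [hf x])
    · simp [jumpExt, M.jump_eq_zero ha]
  all_goals simp [jumpExt]

theorem IsLyapunov.exists_growthBound {w : S → ℝ} (hw : M.IsLyapunov w) :
    ∃ c, M.GrowthBound (ennExt w) c := by
  obtain ⟨ρ, b, _, _, hb, _, _, _, _, hdrift, _⟩ := hw.exists_bounds
  exact ⟨_, hdrift.growthBound hw.one_le hb⟩

theorem JumpBounded.mono {G G' : Adjoin S × Adjoin S → ℝ≥0∞} {W : Adjoin S → ℝ≥0∞} {C : ℝ≥0}
    (h : M.JumpBounded G' W) (hG : ∀ p, G p ≤ C * G' p) : M.JumpBounded G W := by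
  obtain ⟨K, hK⟩ := h
  refine ⟨C * K, fun z a => ?_⟩
  calc ∫⁻ y, G (z, Sum.inl y) ∂(M.jumpExt z a)
      ≤ ∫⁻ y, C * G' (z, Sum.inl y) ∂(M.jumpExt z a) := lintegral_mono fun y => hG _
    _ = C * ∫⁻ y, G' (z, Sum.inl y) ∂(M.jumpExt z a) :=
        lintegral_const_mul' _ _ ENNReal.coe_ne_top
    _ ≤ C * (K * W z) := by gcongr; exact hK z a
    _ = (C * K : ℝ≥0) * W z := by push_cast; ring

namespace IsSecondWeight

variable {w w' u : S → ℝ}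

theorem exists_maxRate_mul_le (hw' : M.IsSecondWeight w w') :
    ∃ L : ℝ≥0, ∀ z, (ennExt M.maxRate z + 1) * ennExt w' z ≤ L * ennExt w z := by
  obtain ⟨L, -, -, hL, -, -, hLw, -⟩ := hw'.exists_bounds
  refine ⟨L.toNNReal, ?_⟩
  rintro (x | x)
  · have hq : 0 ≤ M.maxRate x := M.maxRate_nonneg x
    rw [ennExt_inl, ennExt_inl, ennExt_inl, ENNReal.ofNNReal_toNNReal, ← ENNReal.ofReal_one,
      ← ENNReal.ofReal_add hq zero_le_one, ← ENNReal.ofReal_mul (by positivity),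
      ← ENNReal.ofReal_mul hL]
    exact ENNReal.ofReal_le_ofReal (hLw x)
  · simp

theorem jumpBounded_fst (hw' : M.IsSecondWeight w w') :
    M.JumpBounded (fun p => ennExt w' p.1) (ennExt w) := by
  obtain ⟨L, hL⟩ := hw'.exists_maxRate_mul_le
  refine ⟨L, fun z a => ?_⟩
  calc ∫⁻ _, ennExt w' z ∂(M.jumpExt z a)
      = M.jumpExt z a univ * ennExt w' z := by rw [lintegral_const, mul_comm]
    _ ≤ (ennExt M.maxRate z + 1) * ennExt w' z := by
        gcongr
        exact (M.jumpExt_univ_le z a).trans le_self_add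
    _ ≤ L * ennExt w z := hL z

theorem jumpBounded_snd (hw' : M.IsSecondWeight w w') :
    M.JumpBounded (fun p => ennExt w' p.2) (ennExt w) := by
  obtain ⟨L, hL⟩ := hw'.exists_maxRate_mul_le
  obtain ⟨_, ρ, b, _, _, hb, _, hdrift⟩ := hw'.exists_bounds
  set c := (ρ + b).toNNReal
  refine ⟨(1 + c) * L, fun z a => ?_⟩
  have hrate : M.jumpExt z a univ + c ≤ (1 + c) * (ennExt M.maxRate z + 1) := calc
    M.jumpExt z a univ + c ≤ ennExt M.maxRate z + c := by
        gcongr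
        exact M.jumpExt_univ_le z a
    _ ≤ ennExt M.maxRate z + c + (1 + c * ennExt M.maxRate z) := le_self_add
    _ = (1 + c) * (ennExt M.maxRate z + 1) := by ring
  calc ∫⁻ y, ennExt w' (Sum.inl y) ∂(M.jumpExt z a)
      ≤ (M.jumpExt z a univ + c) * ennExt w' z := hdrift.growthBound hw'.one_le hb z a
    _ ≤ (1 + c) * (ennExt M.maxRate z + 1) * ennExt w' z := by gcongr
    _ ≤ (1 + c) * (L * ennExt w z) := by
        rw [mul_assoc]
        exact mul_le_mul_right (hL z) _
    _ = ((1 + c) * L : ℝ≥0) * ennExt w z := by push_cast; ring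

theorem jumpBounded_ennExt_fst (hw' : M.IsSecondWeight w w') (hu : WeightedBounded w' u) :
    M.JumpBounded (fun p => ennExt u p.1) (ennExt w) := by
  obtain ⟨C, hC⟩ := hu.exists_ennExt_le hw'.one_le
  exact hw'.jumpBounded_fst.mono fun p => hC p.1

theorem jumpBounded_ennExt_snd (hw' : M.IsSecondWeight w w') (hu : WeightedBounded w' u) :
    M.JumpBounded (fun p => ennExt u p.2) (ennExt w) := by
  obtain ⟨C, hC⟩ := hu.exists_ennExt_le hw'.one_le
  exact hw'.jumpBounded_snd.mono fun p => hC p.2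

theorem exists_ennExt_le (hw' : M.IsSecondWeight w w') (hu : WeightedBounded w' u) :
    ∃ K : ℝ≥0, ∀ z, ennExt u z ≤ K * ennExt w z := by
  obtain ⟨C, hC⟩ := hu.exists_ennExt_le hw'.one_le
  obtain ⟨L, hL⟩ := hw'.exists_maxRate_mul_le
  refine ⟨C * L, fun z => ?_⟩
  calc ennExt u z ≤ C * ennExt w' z := hC z
    _ ≤ C * ((ennExt M.maxRate z + 1) * ennExt w' z) := by
        gcongr
        exact le_mul_of_one_le_left zero_le le_add_self
    _ ≤ C * (L * ennExt w z) := mul_le_mul_right (hL z) _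
    _ = (C * L : ℝ≥0) * ennExt w z := by push_cast; ring

theorem integrable_jump (hw' : M.IsSecondWeight w w') (hu : WeightedBounded w' u) (x : S) (a : A) :
    Integrable u (M.jump x a) := by
  obtain ⟨K, hK⟩ := hw'.jumpBounded_ennExt_snd hu.abs
  refine ⟨hu.1.aestronglyMeasurable, ?_⟩
  simp_rw [HasFiniteIntegral, Real.enorm_eq_ofReal_abs]
  exact (hK (Sum.inl x) (Sum.inl a)).trans_lt
    (ENNReal.mul_lt_top ENNReal.coe_lt_top ENNReal.ofReal_lt_top)

theorem integrable_q (hw' : M.IsSecondWeight w w') (hu : WeightedBounded w' u) (x : S) (a : A) :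
    (M.q x a).Integrable u :=
  M.integrable_q_iff.2 (hw'.integrable_jump hu x a)

end IsSecondWeight

theorem generator_of_nonneg {u : S → ℝ} (hu : ∀ x a, Integrable u (M.jump x a))
    (hu0 : ∀ x, 0 ≤ u x) (z : Adjoin S) (a : Adjoin A) :
    M.generator u z a = (∫⁻ y, ennExt u (Sum.inl y) ∂(M.jumpExt z a)).toReal
      - (∫⁻ _, ennExt u z ∂(M.jumpExt z a)).toReal := by
  rcases z with x | x <;> rcases a with a | a
  · rw [generator, M.integral_q (hu x a),
      integral_eq_lintegral_of_nonneg_ae (ae_of_all _ hu0) (hu x a).aestronglyMeasurable]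
    simp [jumpExt, M.jump_univ, M.rate_nonneg, hu0, mul_comm]
  all_goals simp [jumpExt, generator]

theorem generator_sub {u v : S → ℝ} (hu : ∀ x a, Integrable u (M.jump x a))
    (hv : ∀ x a, Integrable v (M.jump x a)) (z : Adjoin S) (a : Adjoin A) :
    M.generator (u - v) z a = M.generator u z a - M.generator v z a := by
  rcases z with x | x <;> rcases a with a | a
  · simp only [generator]
    rw [M.integral_q (hu x a), M.integral_q (hv x a), M.integral_q ((hu x a).sub (hv x a))]
    simp only [Pi.sub_apply, integral_sub (hu x a) (hv x a)]
    ring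
  all_goals simp [generator]

end Model

section Histories

variable {S : Type*}

/-- The history `(θ_0, x_0, …, θ_k, x_k)` of a path. -/
def PathSpace.hist (k : ℕ) (ω : PathSpace S) : Hist S k := fun i => ω.1 i

/-- The time `T_k` of the last jump of a history. -/
def Hist.time {k : ℕ} (h : Hist S k) : ℝ≥0∞ := ∑ i, (h i).1

theorem PathSpace.jumpTime_succ (k : ℕ) (ω : PathSpace S) :
    jumpTime (k + 1) ω = jumpTime k ω + (ω.1 (k + 1)).1 :=
  Finset.sum_range_succ _ _

theorem PathSpace.time_hist (k : ℕ) (ω : PathSpace S) : (hist k ω).time = jumpTime k ω := by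
  have hrange : Finset.range (k + 1) = Finset.Iic k := by
    ext i
    simp
  rw [jumpTime, hrange, ← Finset.sum_coe_sort]
  rfl

variable [MeasurableSpace S]

theorem Hist.measurable_time (k : ℕ) : Measurable (Hist.time : Hist S k → ℝ≥0∞) :=
  Finset.measurable_sum _ fun i _ => measurable_fst.comp (measurable_pi_apply i)

theorem measurable_startMark : Measurable fun x : S => ((0, Sum.inl x) : Mark S) :=
  measurable_const.prodMk measurable_inl

theorem measurable_jumpMark :
    Measurable fun p : ℝ × S => ((ENNReal.ofReal p.1, Sum.inl p.2) : Mark S) :=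
  (ENNReal.measurable_ofReal.comp measurable_fst).prodMk (measurable_inl.comp measurable_snd)

theorem measurableSet_cemetery : MeasurableSet {m : Mark S | m = cemetery S} := by
  convert (measurableSet_singleton (∞ : ℝ≥0∞)).prod
    (measurableSet_range_inr : MeasurableSet (range Sum.inr : Set (Adjoin S))) using 1
  ext ⟨t, x⟩
  rcases x with x | x <;> simp [cemetery]

end Histories

section TrajMeasure

theorem map_eval_zero_trajMeasure {X : ℕ → Type*} [∀ n, MeasurableSpace (X n)]
    (μ : Measure (X 0)) (κ : (n : ℕ) → Kernel ((i : Finset.Iic n) → X i) (X (n + 1)))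
    [∀ n, IsMarkovKernel (κ n)] : (Kernel.trajMeasure μ κ).map (fun ω => ω 0) = μ := by
  let head : ((i : Finset.Iic 0) → X i) → X 0 := fun h => h ⟨0, Finset.mem_Iic.2 le_rfl⟩
  have hhead : Measurable head := measurable_pi_apply _
  change (Kernel.trajMeasure μ κ).map (head ∘ Preorder.frestrictLe 0) = μ
  rw [← Measure.map_map hhead (Preorder.measurable_frestrictLe 0),
    Kernel.trajMeasure, Measure.map_comp _ _ (Preorder.measurable_frestrictLe 0),
    Kernel.traj_map_frestrictLe, Kernel.partialTraj_self, Measure.id_comp]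
  exact (Measure.map_map (μ := μ) hhead
    (MeasurableEquiv.piUnique fun i : Finset.Iic 0 => X i).symm.measurable).trans Measure.map_id

end TrajMeasure

namespace Policy

section StepKernel

variable {S A : Type*} [MeasurableSpace S] [MeasurableSpace A] [StandardBorelSpace S]
  {M : Model S A} (π : Policy M)

theorem lintegral_intensity (k : ℕ) (h : Hist S k) (s : ℝ) {f : S → ℝ≥0∞} (hf : Measurable f) :
    ∫⁻ y, f y ∂(π.intensity k (h, s))
      = ∫⁻ a, ∫⁻ y, f y ∂(M.jumpExt h.last a) ∂(π.histProb k h s) :=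
  Measure.lintegral_bind (M.measurable_jumpExt.comp measurable_prodMk_left).aemeasurable
    hf.aemeasurable

theorem measurable_intensity_univ (k : ℕ) (h : Hist S k) :
    Measurable fun s : ℝ => π.intensity k (h, s) univ :=
  ((π.intensity k).measurable_coe MeasurableSet.univ).comp measurable_prodMk_left

theorem intensity_eq_zero (k : ℕ) {h : Hist S k} (hh : h.last = Sum.inr ()) (s : ℝ) :
    π.intensity k (h, s) = 0 := by
  change (π.histProb k h s).bind (fun a => M.jumpExt h.last a) = 0
  rw [hh]
  exact Measure.bind_zero_right' _

theorem lintegral_stepKernel (k : ℕ) (h : Hist S k) {H : Mark S → ℝ≥0∞} (hH : Measurable H) :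
    ∫⁻ m, H m ∂(π.stepKernel k h) =
      (∫⁻ s in Ioi (0 : ℝ), expNeg (π.cumIntensity k h s) *
        ∫⁻ y, H (ENNReal.ofReal s, Sum.inl y) ∂(π.intensity k (h, s)))
      + expNeg (π.totalIntensity k h) * H (cemetery S) := by
  have hd : Measurable (Function.uncurry fun (h : Hist S k) (p : ℝ × S) =>
      expNeg (π.cumIntensity k h p.1)) :=
    measurable_expNeg.comp ((π.measurable_cumIntensity k).comp
      (measurable_fst.prodMk (measurable_fst.comp measurable_snd)))
  have hd' : Measurable (Function.uncurry fun (h : Hist S k) (_ : Mark S) =>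
      expNeg (π.totalIntensity k h)) :=
    measurable_expNeg.comp ((π.measurable_totalIntensity k).comp measurable_fst)
  have hHm : Measurable fun p : ℝ × S => H (ENNReal.ofReal p.1, Sum.inl p.2) :=
    hH.comp measurable_jumpMark
  have hdh : Measurable fun p : ℝ × S => expNeg (π.cumIntensity k h p.1) :=
    hd.comp measurable_prodMk_left
  rw [stepKernel, _root_.add_apply, lintegral_add_measure, Kernel.map_apply _ measurable_jumpMark,
    lintegral_map hH measurable_jumpMark, Kernel.lintegral_withDensity _ hd _ hHm,
    Kernel.lintegral_withDensity _ hd' _ hH, Kernel.lintegral_compProd _ _ _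
      (f := fun p => expNeg (π.cumIntensity k h p.1) * H (ENNReal.ofReal p.1, Sum.inl p.2))
      (hdh.mul hHm)]
  simp only [Kernel.const_apply]
  rw [lintegral_const_mul _ hH, lintegral_dirac' _ hH]
  congr 1
  exact lintegral_congr fun s => lintegral_const_mul _ (hHm.comp measurable_prodMk_left)

theorem setLIntegral_stepKernel (k : ℕ) (h : Hist S k) {H : Mark S → ℝ≥0∞} (hH : Measurable H)
    {r : ℝ} (hr : 0 ≤ r) :
    ∫⁻ m in {m | m.1 ≤ ENNReal.ofReal r}, H m ∂(π.stepKernel k h) =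
      ∫⁻ s in Ioc 0 r, expNeg (π.cumIntensity k h s) *
        ∫⁻ y, H (ENNReal.ofReal s, Sum.inl y) ∂(π.intensity k (h, s)) := by
  have hm : MeasurableSet {m : Mark S | m.1 ≤ ENNReal.ofReal r} :=
    measurableSet_le measurable_fst measurable_const
  have hcem : cemetery S ∉ {m : Mark S | m.1 ≤ ENNReal.ofReal r} := by simp [cemetery]
  rw [← lintegral_indicator hm, π.lintegral_stepKernel k h (hH.indicator hm),
    indicator_of_notMem hcem, mul_zero, add_zero, ← Ioi_inter_Iic, inter_comm,
    ← setLIntegral_indicator measurableSet_Iic]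
  refine lintegral_congr fun s => ?_
  by_cases hs : s ≤ r <;>
    simp [hs, ENNReal.ofReal_le_ofReal_iff hr]

theorem stepKernel_lt (k : ℕ) (h : Hist S k) {r : ℝ} (hr : 0 ≤ r) :
    π.stepKernel k h {m | ENNReal.ofReal r < m.1} = expNeg (π.cumIntensity k h r) := by
  have hm : MeasurableSet {m : Mark S | m.1 ≤ ENNReal.ofReal r} :=
    measurableSet_le measurable_fst measurable_const
  have hcompl : {m : Mark S | ENNReal.ofReal r < m.1} = {m | m.1 ≤ ENNReal.ofReal r}ᶜ := by
    ext m
    simp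
  have hle := π.setLIntegral_stepKernel k h measurable_one hr
  simp only [Pi.one_apply, lintegral_one, Measure.restrict_apply_univ] at hle
  obtain ⟨C, hC⟩ := π.intensity_bounded k h
  have hsum := lintegral_hazard_Ioc (π.measurable_intensity_univ k h) hC r
  rw [hcompl, prob_compl_eq_one_sub hm, hle, ← hsum]
  exact ENNReal.add_sub_cancel_left (ne_top_of_le_ne_top ENNReal.one_ne_top (hsum ▸ le_self_add))

theorem measurable_lintegral_intensity (k : ℕ) (h : Hist S k) {H : Mark S → ℝ≥0∞}
    (hH : Measurable H) :
    Measurable fun s : ℝ => ∫⁻ y, H (ENNReal.ofReal s, Sum.inl y) ∂(π.intensity k (h, s)) :=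
  Measurable.lintegral_kernel_prod_right' (κ := (π.intensity k).comap (Prod.mk h)
    measurable_prodMk_left) (hH.comp measurable_jumpMark)

-- The density of `θ_{k+1}` is the intensity times the probability that `s < θ_{k+1}`; writing the
-- latter as an integral over `m` and exchanging the integrals gives the compensator.
theorem lintegral_stepKernel_eq_lintegral_intensity (k : ℕ) (h : Hist S k) {H : Mark S → ℝ≥0∞}
    (hH : Measurable H) (hH0 : H (cemetery S) = 0) :
    ∫⁻ m, H m ∂(π.stepKernel k h) =
      ∫⁻ m, (∫⁻ s in Ioi (0 : ℝ), {s : ℝ | ENNReal.ofReal s < m.1}.indicator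
        (fun s => ∫⁻ y, H (ENNReal.ofReal s, Sum.inl y) ∂(π.intensity k (h, s))) s)
        ∂(π.stepKernel k h) := by
  rw [π.lintegral_stepKernel k h hH, hH0, mul_zero, add_zero]
  set Φ : ℝ → ℝ≥0∞ := fun s => ∫⁻ y, H (ENNReal.ofReal s, Sum.inl y) ∂(π.intensity k (h, s))
  have hΦ : Measurable Φ := π.measurable_lintegral_intensity k h hH
  have hset : MeasurableSet {p : Mark S × ℝ | ENNReal.ofReal p.2 < p.1.1} :=
    measurableSet_lt (ENNReal.measurable_ofReal.comp measurable_snd)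
      (measurable_fst.comp measurable_fst)
  rw [lintegral_lintegral_swap (μ := π.stepKernel k h)
    (f := fun m s => {s : ℝ | ENNReal.ofReal s < m.1}.indicator Φ s)
    ((hΦ.comp measurable_snd).indicator hset).aemeasurable]
  refine setLIntegral_congr_fun measurableSet_Ioi fun s hs => ?_
  have hind : ∀ m : Mark S, {s : ℝ | ENNReal.ofReal s < m.1}.indicator Φ s
      = {m : Mark S | ENNReal.ofReal s < m.1}.indicator (fun _ => Φ s) m := fun _ => rfl
  simp_rw [hind]
  rw [lintegral_indicator_const (measurableSet_lt measurable_const measurable_fst),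
    π.stepKernel_lt k h (le_of_lt hs), mul_comm]

theorem ae_stepKernel_regular (k : ℕ) (h : Hist S k) :
    ∀ᵐ m ∂(π.stepKernel k h), (m.1 ∈ Ioo 0 ∞ ∧ m.2 ∈ range Sum.inl) ∨ m = cemetery S := by
  have hreg : MeasurableSet {m : Mark S | (m.1 ∈ Ioo 0 ∞ ∧ m.2 ∈ range Sum.inl) ∨
      m = cemetery S} :=
    ((measurable_fst measurableSet_Ioo).inter (measurable_snd measurableSet_range_inl)).union
      measurableSet_cemetery
  rw [ae_iff]
  change π.stepKernel k h {m | (m.1 ∈ Ioo 0 ∞ ∧ m.2 ∈ range Sum.inl) ∨ m = cemetery S}ᶜ = 0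
  rw [← lintegral_indicator_one hreg.compl,
    π.lintegral_stepKernel k h (measurable_one.indicator hreg.compl),
    indicator_of_notMem (by simp), mul_zero, add_zero, setLIntegral_congr_fun
      (g := fun _ => 0) measurableSet_Ioi fun s hs => ?_, lintegral_zero]
  have hjump : ∀ y : S, ({m : Mark S | (m.1 ∈ Ioo 0 ∞ ∧ m.2 ∈ range Sum.inl) ∨
      m = cemetery S}ᶜ.indicator 1 (ENNReal.ofReal s, Sum.inl y) : ℝ≥0∞) = 0 := fun y =>
    indicator_of_notMem (by simpa using fun hc => absurd hs (not_lt.2 hc)) _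
  simp only [hjump, lintegral_zero, mul_zero]

theorem ae_stepKernel_eq_cemetery (k : ℕ) {h : Hist S k} (hh : h.last = Sum.inr ()) :
    ∀ᵐ m ∂(π.stepKernel k h), m = cemetery S := by
  rw [ae_iff]
  change π.stepKernel k h {m | m = cemetery S}ᶜ = 0
  rw [← lintegral_indicator_one measurableSet_cemetery.compl,
    π.lintegral_stepKernel k h (measurable_one.indicator measurableSet_cemetery.compl)]
  simp [π.intensity_eq_zero k hh]

end StepKernel

section Law

variable {S A : Type*} [MeasurableSpace S] [MeasurableSpace A] [StandardBorelSpace S]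
  {M : Model S A} (π : Policy M)

/-- The law of the sequence of sojourn times and states on the space of all sequences; `law` is its
restriction to the set of paths. -/
def seqLaw (γ : Measure S) : Measure (ℕ → Mark S) :=
  Kernel.trajMeasure (X := fun _ => Mark S) (γ.map fun x => ((0, Sum.inl x) : Mark S)) π.stepKernel

variable (γ : Measure S)

theorem map_eval_zero_seqLaw :
    (π.seqLaw γ).map (fun ω => ω 0) = γ.map fun x => ((0, Sum.inl x) : Mark S) :=
  map_eval_zero_trajMeasure (X := fun _ => Mark S) _ _

variable [IsProbabilityMeasure γ]

instance : IsProbabilityMeasure (π.seqLaw γ) := by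
  have : IsProbabilityMeasure (γ.map fun x => ((0, Sum.inl x) : Mark S)) :=
    Measure.isProbabilityMeasure_map measurable_startMark.aemeasurable
  unfold seqLaw
  infer_instance

theorem lintegral_seqLaw_succ (k : ℕ) {G : Hist S k × Mark S → ℝ≥0∞} (hG : Measurable G) :
    ∫⁻ ω, G (Preorder.frestrictLe k ω, ω (k + 1)) ∂(π.seqLaw γ)
      = ∫⁻ ω, ∫⁻ m, G (Preorder.frestrictLe k ω, m) ∂(π.stepKernel k (Preorder.frestrictLe k ω))
        ∂(π.seqLaw γ) := by
  have : IsProbabilityMeasure (γ.map fun x => ((0, Sum.inl x) : Mark S)) :=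
    Measure.isProbabilityMeasure_map measurable_startMark.aemeasurable
  have hdis := Kernel.map_frestrictLe_trajMeasure_compProd_eq_map_trajMeasure
    (X := fun _ => Mark S) (κ := π.stepKernel) (a := k)
    (μ₀ := γ.map fun x => ((0, Sum.inl x) : Mark S))
  have hr : Measurable (Preorder.frestrictLe (π := fun _ => Mark S) k) :=
    Preorder.measurable_frestrictLe k
  rw [← lintegral_map (μ := π.seqLaw γ) hG (hr.prodMk (measurable_pi_apply (k + 1))), seqLaw,
    ← hdis, Measure.lintegral_compProd hG, lintegral_map hG.lintegral_kernel_prod_right' hr]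

theorem ae_seqLaw_succ (k : ℕ) {p : Hist S k × Mark S → Prop} (hp : MeasurableSet {z | p z})
    (h : ∀ h : Hist S k, ∀ᵐ m ∂(π.stepKernel k h), p (h, m)) :
    ∀ᵐ ω ∂(π.seqLaw γ), p (Preorder.frestrictLe k ω, ω (k + 1)) := by
  have hpm : Measurable fun ω : ℕ → Mark S =>
      ((Preorder.frestrictLe k ω, ω (k + 1)) : Hist S k × Mark S) :=
    (Preorder.measurable_frestrictLe k).prodMk (measurable_pi_apply (k + 1))
  have hstep : ∀ h' : Hist S k,
      ∫⁻ m, ({z | p z}ᶜ.indicator 1 (h', m) : ℝ≥0∞) ∂(π.stepKernel k h') = 0 := fun h' =>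
    lintegral_eq_zero_of_ae_eq_zero ((h h').mono fun m hm =>
      indicator_of_notMem (fun hc : ¬ p (h', m) => hc hm) _)
  have hzero := π.lintegral_seqLaw_succ γ k (measurable_one.indicator hp.compl)
  simp only [hstep, lintegral_zero] at hzero
  have hae := (lintegral_eq_zero_iff ((measurable_one.indicator hp.compl).comp hpm)).1 hzero
  filter_upwards [hae] with ω hω
  by_contra hc
  rw [Function.comp_apply, indicator_of_mem (show _ ∈ {z | p z}ᶜ from hc)] at hω
  exact one_ne_zero hω

theorem ae_seqLaw_absorb (n : ℕ) :
    ∀ᵐ ω ∂(π.seqLaw γ), ω n = cemetery S → ω (n + 1) = cemetery S := by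
  have hlast : MeasurableSet {z : Hist S n × Mark S |
      z.1 ⟨n, Finset.mem_Iic.2 le_rfl⟩ = cemetery S} :=
    ((measurable_pi_apply (X := fun _ : Finset.Iic n => Mark S)
      ⟨n, Finset.mem_Iic.2 le_rfl⟩).comp measurable_fst) measurableSet_cemetery
  refine π.ae_seqLaw_succ γ n (p := fun z =>
    z.1 ⟨n, Finset.mem_Iic.2 le_rfl⟩ = cemetery S → z.2 = cemetery S)
    (hlast.imp (measurable_snd measurableSet_cemetery)) fun h => ?_
  by_cases hc : h ⟨n, Finset.mem_Iic.2 le_rfl⟩ = cemetery S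
  · have hh : h.last = Sum.inr () := by
      rw [Hist.last, hc]
      rfl
    filter_upwards [π.ae_stepKernel_eq_cemetery n hh] with m hm _ using hm
  · exact Eventually.of_forall fun m hm => absurd hm hc

theorem ae_seqLaw_isPath : ∀ᵐ ω ∂(π.seqLaw γ), IsPath ω := by
  have hstart : ∀ᵐ ω ∂(π.seqLaw γ), (ω 0).1 = 0 ∧ (ω 0).2 ∈ range Sum.inl := by
    refine ae_of_ae_map (p := fun m : Mark S => m.1 = 0 ∧ m.2 ∈ range Sum.inl)
      (measurable_pi_apply (X := fun _ => Mark S) 0).aemeasurable ?_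
    rw [π.map_eval_zero_seqLaw γ]
    refine (ae_map_iff measurable_startMark.aemeasurable ((measurable_fst
      (measurableSet_singleton 0)).inter (measurable_snd measurableSet_range_inl))).2 ?_
    exact Eventually.of_forall fun x => ⟨rfl, mem_range_self x⟩
  have hsucc : ∀ n, ∀ᵐ ω ∂(π.seqLaw γ), ((ω (n + 1)).1 ∈ Ioo 0 ∞ ∧
      (ω (n + 1)).2 ∈ range Sum.inl) ∨ ω (n + 1) = cemetery S := fun n =>
    π.ae_seqLaw_succ γ n (p := fun z => (z.2.1 ∈ Ioo 0 ∞ ∧ z.2.2 ∈ range Sum.inl) ∨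
      z.2 = cemetery S) (measurable_snd
        (((measurable_fst measurableSet_Ioo).inter
          (measurable_snd measurableSet_range_inl)).union measurableSet_cemetery))
      fun h => π.ae_stepKernel_regular n h
  filter_upwards [hstart, ae_all_iff.2 hsucc, ae_all_iff.2 (π.ae_seqLaw_absorb γ)]
    with ω h0 h1 h2 using ⟨h0, h1, h2⟩

theorem map_law : (π.law γ).map Subtype.val = π.seqLaw γ := by
  have he : MeasurableEmbedding (Subtype.val : PathSpace S → ℕ → Mark S) :=
    MeasurableEmbedding.subtype_coe measurableSet_isPath
  change ((π.seqLaw γ).comap Subtype.val).map Subtype.val = _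
  rw [he.map_comap, Subtype.range_coe_subtype]
  exact Measure.restrict_eq_self_of_ae_mem (π.ae_seqLaw_isPath γ)

instance : IsProbabilityMeasure (π.law γ) :=
  ⟨by rw [← preimage_univ (f := (Subtype.val : PathSpace S → ℕ → Mark S)),
    ← Measure.map_apply measurable_subtype_coe MeasurableSet.univ, π.map_law, measure_univ]⟩

theorem lintegral_law_zero {G : Mark S → ℝ≥0∞} (hG : Measurable G) :
    ∫⁻ ω, G (ω.1 0) ∂(π.law γ) = ∫⁻ x, G (0, Sum.inl x) ∂γ := by
  have heval : Measurable fun ω : ℕ → Mark S => ω 0 := measurable_pi_apply 0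
  rw [← lintegral_map (f := fun ω : ℕ → Mark S => G (ω 0)) (hG.comp heval) measurable_subtype_coe,
    π.map_law, ← lintegral_map hG heval, π.map_eval_zero_seqLaw, lintegral_map hG
      measurable_startMark]

theorem lintegral_law_succ (k : ℕ) {G : Hist S k × Mark S → ℝ≥0∞} (hG : Measurable G) :
    ∫⁻ ω, G (PathSpace.hist k ω, ω.1 (k + 1)) ∂(π.law γ)
      = ∫⁻ ω, ∫⁻ m, G (PathSpace.hist k ω, m) ∂(π.stepKernel k (PathSpace.hist k ω))
        ∂(π.law γ) := by
  have hr : Measurable (Preorder.frestrictLe (π := fun _ => Mark S) k) :=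
    Preorder.measurable_frestrictLe k
  have hseq := π.lintegral_seqLaw_succ γ k hG
  rw [← π.map_law, lintegral_map
    (f := fun ω : ℕ → Mark S => G (Preorder.frestrictLe k ω, ω (k + 1)))
    (hG.comp (hr.prodMk (measurable_pi_apply (k + 1)))) measurable_subtype_coe,
    lintegral_map (f := fun ω : ℕ → Mark S => ∫⁻ m, G (Preorder.frestrictLe k ω, m)
      ∂(π.stepKernel k (Preorder.frestrictLe k ω)))
      (hG.lintegral_kernel_prod_right'.comp hr) measurable_subtype_coe] at hseq
  exact hseq

end Law

end Policy

section PathProperties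

variable {S : Type*}

namespace PathSpace

theorem jumpTime_mono (ω : PathSpace S) : Monotone fun k => jumpTime k ω :=
  monotone_nat_of_le_succ fun k => by
    rw [jumpTime_succ]
    exact le_self_add

theorem jumpTime_zero (ω : PathSpace S) : jumpTime 0 ω = 0 := by
  simp [jumpTime, ω.2.zero.1]

theorem state_mem_range_inl {ω : PathSpace S} {k : ℕ} (h : jumpTime k ω ≠ ∞) :
    state k ω ∈ range Sum.inl := by
  rcases k with - | k
  · exact ω.2.zero.2
  · rcases ω.2.succ k with hreg | hcem
    · exact hreg.2
    · simp [jumpTime_succ, hcem, cemetery] at h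

/-- The set of paths whose state at time `t` is the one entered at the `k`-th jump. -/
def sojourn (k : ℕ) (t : ℝ≥0) : Set (PathSpace S) :=
  {ω | jumpTime k ω ≤ t ∧ t < jumpTime (k + 1) ω}

theorem eq_of_mem_sojourn {ω : PathSpace S} {t : ℝ≥0} {m n : ℕ} (hm : ω ∈ sojourn m t)
    (hn : ω ∈ sojourn n t) : m = n := by
  by_contra hne
  rcases Nat.lt_or_gt_of_ne hne with h | h
  · exact absurd (hm.2.trans_le (jumpTime_mono ω h)) (not_lt.2 hn.1)
  · exact absurd (hn.2.trans_le (jumpTime_mono ω h)) (not_lt.2 hm.1)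

theorem process_eq_state {ω : PathSpace S} {t : ℝ≥0} {m : ℕ} (h : ω ∈ sojourn m t) :
    process t ω = state m ω := by
  classical
  have hex : ∃ m, jumpTime m ω ≤ t ∧ t < jumpTime (m + 1) ω := ⟨m, h⟩
  rw [process, dif_pos hex, eq_of_mem_sojourn (Nat.find_spec hex) h]

theorem process_eq_inr {ω : PathSpace S} {t : ℝ≥0} (h : ∀ m, ω ∉ sojourn m t) :
    process t ω = Sum.inr () :=
  dif_neg (not_exists.2 h)

theorem jumpTime_le_of_notMem_sojourn {ω : PathSpace S} {t : ℝ≥0} (h : ∀ m, ω ∉ sojourn m t)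
    (m : ℕ) : jumpTime m ω ≤ t := by
  induction m with
  | zero => simp [jumpTime_zero]
  | succ m ih => exact not_lt.1 fun hlt => h m ⟨ih, hlt⟩

theorem process_mem_range_inl {ω : PathSpace S} {t : ℝ≥0} {m : ℕ} (h : ω ∈ sojourn m t) :
    process t ω ∈ range Sum.inl := by
  rw [process_eq_state h]
  exact state_mem_range_inl (ne_top_of_le_ne_top ENNReal.coe_ne_top h.1)

theorem tsum_indicator_sojourn {f : PathSpace S → ℝ≥0∞} {t : ℝ≥0} {ω : PathSpace S}
    (hf : process t ω = Sum.inr () → f ω = 0) :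
    ∑' k, (sojourn k t).indicator f ω = f ω := by
  by_cases hex : ∃ m, ω ∈ sojourn m t
  · obtain ⟨m, hm⟩ := hex
    rw [tsum_eq_single m fun k hk =>
      indicator_of_notMem (fun h => hk (eq_of_mem_sojourn h hm)) _, indicator_of_mem hm]
  · push Not at hex
    simp [indicator_of_notMem (hex _), hf (process_eq_inr hex)]

theorem tsum_indicator_jumpTime_succ_le {ω : PathSpace S} {t : ℝ≥0} {m : ℕ}
    (h : ω ∈ sojourn m t) (g : ℕ → PathSpace S → ℝ≥0∞) :
    ∑' k, {ω | jumpTime (k + 1) ω ≤ t}.indicator (g k) ω = ∑ k ∈ Finset.range m, g k ω := by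
  have hmem : ∀ k, ω ∈ {ω : PathSpace S | jumpTime (k + 1) ω ≤ t} ↔ k ∈ Finset.range m := by
    intro k
    rw [Finset.mem_range]
    refine ⟨fun hk => not_le.1 fun hmk => ?_, fun hk => (jumpTime_mono ω hk).trans h.1⟩
    exact absurd (h.2.trans_le (jumpTime_mono ω (Nat.succ_le_succ hmk))) (not_lt.2 hk)
  rw [tsum_eq_sum fun k hk => indicator_of_notMem (fun hc => hk ((hmem k).1 hc)) _]
  exact Finset.sum_congr rfl fun k hk => indicator_of_mem ((hmem k).2 hk) _

theorem add_tsum_state_eq_add_tsum_state_succ {ω : PathSpace S} {t : ℝ≥0} {m : ℕ}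
    (h : ω ∈ sojourn m t) (f : Adjoin S → ℝ≥0∞) :
    f (process t ω) + ∑' k, {ω | jumpTime (k + 1) ω ≤ t}.indicator (fun ω => f (state k ω)) ω
      = f (state 0 ω) +
        ∑' k, {ω | jumpTime (k + 1) ω ≤ t}.indicator (fun ω => f (state (k + 1) ω)) ω := by
  rw [tsum_indicator_jumpTime_succ_le h, tsum_indicator_jumpTime_succ_le h, process_eq_state h,
    add_comm, ← Finset.sum_range_succ fun k => f (state k ω), Finset.sum_range_succ', add_comm]

theorem isPath_extend_hist (k : ℕ) (ω : PathSpace S) : IsPath (hist k ω).extend := by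
  have hle : ∀ n ≤ k, (hist k ω).extend n = ω.1 n := fun n hn => by
    simp [Hist.extend, hist, hn]
  have hgt : ∀ n, ¬ n ≤ k → (hist k ω).extend n = cemetery S := fun n hn => by
    simp [Hist.extend, hn]
  refine ⟨?_, fun n => ?_, fun n hn => ?_⟩
  · rw [hle 0 (Nat.zero_le k)]
    exact ω.2.zero
  · by_cases h : n + 1 ≤ k
    · rw [hle _ h]
      exact ω.2.succ n
    · exact Or.inr (hgt _ h)
  · by_cases h : n + 1 ≤ k
    · rw [hle _ h]
      rw [hle _ (Nat.le_of_succ_le h)] at hn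
      exact ω.2.absorb n hn
    · exact hgt _ h

/-- The path with the same history up to the `k`-th jump as `ω` and no further jumps; it is the
path on which `Policy.histProb` evaluates a policy. -/
def stopped (k : ℕ) (ω : PathSpace S) : PathSpace S := ⟨(hist k ω).extend, isPath_extend_hist k ω⟩

theorem stopped_apply {k i : ℕ} (ω : PathSpace S) (hi : i ≤ k) : (stopped k ω).1 i = ω.1 i := by
  simp [stopped, Hist.extend, hist, hi]

theorem jumpTime_congr {k : ℕ} {ω ω' : PathSpace S} (h : ∀ i ≤ k, ω.1 i = ω'.1 i) :
    jumpTime k ω = jumpTime k ω' :=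
  Finset.sum_congr rfl fun i hi => by rw [h i (Nat.lt_succ_iff.1 (Finset.mem_range.1 hi))]

theorem jumpTime_stopped (k : ℕ) (ω : PathSpace S) : jumpTime k (stopped k ω) = jumpTime k ω :=
  jumpTime_congr fun _ hi => stopped_apply ω hi

theorem jumpTime_succ_stopped (k : ℕ) (ω : PathSpace S) : jumpTime (k + 1) (stopped k ω) = ∞ := by
  rw [jumpTime_succ]
  simp [stopped, Hist.extend, cemetery]

variable [MeasurableSpace S]

theorem measurableSet_prod_sojourn (m : ℕ) :
    MeasurableSet {p : ℝ≥0 × PathSpace S | p.2 ∈ sojourn m p.1} :=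
  (measurableSet_le ((measurable_jumpTime m).comp measurable_snd)
    measurable_fst.coe_nnreal_ennreal).inter
  (measurableSet_lt measurable_fst.coe_nnreal_ennreal
    ((measurable_jumpTime (m + 1)).comp measurable_snd))

theorem measurableSet_sojourn (m : ℕ) (t : ℝ≥0) :
    MeasurableSet (sojourn m t : Set (PathSpace S)) :=
  measurable_prodMk_left (measurableSet_prod_sojourn m)

theorem measurable_process : Measurable fun p : ℝ≥0 × PathSpace S => process p.1 p.2 := by
  intro B hB
  have hpre : (fun p : ℝ≥0 × PathSpace S => process p.1 p.2) ⁻¹' B =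
      (⋃ m, {p | p.2 ∈ sojourn m p.1} ∩ {p | state m p.2 ∈ B}) ∪
      ((⋃ m, {p | p.2 ∈ sojourn m p.1})ᶜ ∩ {_p | Sum.inr () ∈ B}) := by
    ext p
    by_cases hex : ∃ m, p.2 ∈ sojourn m p.1
    · obtain ⟨m, hm⟩ := hex
      simp only [mem_preimage, process_eq_state hm, mem_union, mem_iUnion, mem_inter_iff,
        mem_compl_iff]
      refine ⟨fun hB => Or.inl ⟨m, hm, hB⟩, ?_⟩
      rintro (⟨n, hn, hB⟩ | hc)
      · rwa [eq_of_mem_sojourn hm hn]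
      · exact absurd ⟨m, hm⟩ hc.1
    · simp only [mem_preimage, process_eq_inr (not_exists.1 hex), mem_union, mem_iUnion,
        mem_inter_iff, mem_compl_iff]
      refine ⟨fun hB => Or.inr ⟨hex, hB⟩, ?_⟩
      rintro (⟨n, hn, _⟩ | hc)
      · exact absurd ⟨n, hn⟩ hex
      · exact hc.2
  rw [hpre]
  exact (MeasurableSet.iUnion fun m => (measurableSet_prod_sojourn m).inter
    (((measurable_state m).comp measurable_snd) hB)).union
    ((MeasurableSet.iUnion measurableSet_prod_sojourn).compl.inter (MeasurableSet.const _))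

-- A generator `{T_m ≤ r, x_m ∈ Γ}` with `m ≤ k` is decided by the common history; for `m > k` it
-- contains neither path.
theorem mem_iff_mem_of_filtration {ω ω' : PathSpace S} {k : ℕ} {s : ℝ≥0}
    (h : ∀ i ≤ k, ω.1 i = ω'.1 i) (hs : s < jumpTime (k + 1) ω) (hs' : s < jumpTime (k + 1) ω')
    {B : Set (PathSpace S)} (hB : MeasurableSet[filtration S s] B) : ω ∈ B ↔ ω' ∈ B := by
  induction B, hB using MeasurableSpace.generateFrom_induction with
  | hC t ht _ =>
    obtain ⟨m, r, Γ, hr, -, rfl⟩ := ht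
    have hr' : (r : ℝ≥0∞) ≤ s := by exact_mod_cast hr
    by_cases hm : m ≤ k
    · have hstate : state m ω = state m ω' := by rw [state, state, h m hm]
      simp only [mem_ofPred_eq, jumpTime_congr fun i hi => h i (hi.trans hm), hstate]
    · have hm' : k + 1 ≤ m := Nat.lt_of_not_le hm
      have hr₁ : ¬ jumpTime m ω ≤ r :=
        not_le.2 (hr'.trans_lt (hs.trans_le (jumpTime_mono ω hm')))
      have hr₂ : ¬ jumpTime m ω' ≤ r :=
        not_le.2 (hr'.trans_lt (hs'.trans_le (jumpTime_mono ω' hm')))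
      simp only [mem_ofPred_eq, hr₁, hr₂, false_and]
  | empty => simp
  | compl t _ ih => simpa using not_congr ih
  | iUnion f _ ih => simp [ih]

theorem mem_iff_mem_of_predictable {ω ω' : PathSpace S} {k : ℕ} {v : ℝ≥0} (hv : 0 < v)
    (h : ∀ i ≤ k, ω.1 i = ω'.1 i) (hs : v ≤ jumpTime (k + 1) ω) (hs' : v ≤ jumpTime (k + 1) ω')
    {E : Set (ℝ≥0 × PathSpace S)} (hE : MeasurableSet[(filtration S).predictable] E) :
    (v, ω) ∈ E ↔ (v, ω') ∈ E := by
  induction E, hE using MeasurableSpace.generateFrom_induction with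
  | hC t ht _ =>
    rcases ht with ⟨B, -, rfl⟩ | ⟨s, B, hB, rfl⟩
    · simp [hv.ne']
    · by_cases hsv : s < v
      · have hsv' : (s : ℝ≥0∞) < v := by exact_mod_cast hsv
        simpa [hsv] using mem_iff_mem_of_filtration h (hsv'.trans_le hs) (hsv'.trans_le hs') hB
      · simp [hsv]
  | empty => simp
  | compl t _ ih => simpa using not_congr ih
  | iUnion f _ ih => simp [ih]

end PathSpace

end PathProperties

section WeightedJump

variable {S : Type*}

/-- The function `G(x_k, x_{k+1})` of the last two states, on the event `T_{k+1} ≤ t`. -/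
def weightedJump (k : ℕ) (t : ℝ≥0) (G : Adjoin S × Adjoin S → ℝ≥0∞) :
    Hist S k × Mark S → ℝ≥0∞ :=
  {z : Hist S k × Mark S | z.1.time + z.2.1 ≤ t}.indicator fun z => G (z.1.last, z.2.2)

theorem weightedJump_hist (k : ℕ) (t : ℝ≥0) (G : Adjoin S × Adjoin S → ℝ≥0∞) (ω : PathSpace S) :
    weightedJump k t G (PathSpace.hist k ω, ω.1 (k + 1))
      = {ω | PathSpace.jumpTime (k + 1) ω ≤ t}.indicator
        (fun ω => G (PathSpace.state k ω, PathSpace.state (k + 1) ω)) ω := by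
  simp only [weightedJump, indicator, mem_ofPred_eq, PathSpace.time_hist, PathSpace.jumpTime_succ]
  rfl

theorem measurable_weightedJump [MeasurableSpace S] (k : ℕ) (t : ℝ≥0)
    {G : Adjoin S × Adjoin S → ℝ≥0∞} (hG : Measurable G) : Measurable (weightedJump k t G) :=
  (hG.comp (((Hist.measurable_last k).comp measurable_fst).prodMk
    (measurable_snd.comp measurable_snd))).indicator
    (measurableSet_le (((Hist.measurable_time k).comp measurable_fst).add
      (measurable_fst.comp measurable_snd)) measurable_const)

end WeightedJump

namespace Policy

section JumpRate

variable {S A : Type*} [MeasurableSpace S] [MeasurableSpace A] {M : Model S A} (π : Policy M)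

theorem prob_congr {ω ω' : PathSpace S} {k : ℕ} {v : ℝ≥0} (hv : 0 < v)
    (h : ∀ i ≤ k, ω.1 i = ω'.1 i) (hs : v ≤ PathSpace.jumpTime (k + 1) ω)
    (hs' : v ≤ PathSpace.jumpTime (k + 1) ω') : π.prob v ω = π.prob v ω' := by
  ext B hB
  exact (PathSpace.mem_iff_mem_of_predictable hv h hs hs'
    (π.predictable B hB (measurableSet_singleton (π.prob v ω' B)))).2 rfl

theorem histProb_hist {k : ℕ} {ω : PathSpace S} {τ : ℝ≥0} {s : ℝ} (hs : 0 < s)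
    (hτ : PathSpace.jumpTime k ω = τ)
    (h : (τ + s.toNNReal : ℝ≥0) ≤ PathSpace.jumpTime (k + 1) ω) :
    π.histProb k (PathSpace.hist k ω) s = π.prob (τ + s.toNNReal) ω := by
  rw [histProb, dif_pos (PathSpace.isPath_extend_hist k ω)]
  change π.prob ((PathSpace.jumpTime k (PathSpace.stopped k ω)).toNNReal + s.toNNReal)
    (PathSpace.stopped k ω) = _
  rw [PathSpace.jumpTime_stopped, hτ, ENNReal.toNNReal_coe]
  refine π.prob_congr (k := k) (add_pos_of_nonneg_of_pos zero_le (Real.toNNReal_pos.2 hs))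
    (fun i hi => PathSpace.stopped_apply ω hi) ?_ h
  rw [PathSpace.jumpTime_succ_stopped]
  exact le_top

/-- The policy as a kernel. -/
def probKernel : Kernel (ℝ≥0 × PathSpace S) (Adjoin A) where
  toFun p := π.prob p.1 p.2
  measurable' := π.measurable_prob

instance : IsMarkovKernel π.probKernel := ⟨fun p => π.isProbabilityMeasure p.1 p.2⟩

variable [StandardBorelSpace S]

/-- The intensity `∫_A π(da | ω, v) ∫_S q(dy \ {ξ_v} | ξ_v, a) G(ξ_v, y)` at time `v` of the
jumps, weighted with a function of the states before and after the jump. -/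
def jumpRate (G : Adjoin S × Adjoin S → ℝ≥0∞) (v : ℝ≥0) (ω : PathSpace S) : ℝ≥0∞ :=
  ∫⁻ a, ∫⁻ y, G (PathSpace.process v ω, Sum.inl y) ∂(M.jumpExt (PathSpace.process v ω) a)
    ∂(π.prob v ω)

theorem jumpRate_eq_zero (G : Adjoin S × Adjoin S → ℝ≥0∞) {v : ℝ≥0} {ω : PathSpace S}
    (h : PathSpace.process v ω = Sum.inr ()) : π.jumpRate G v ω = 0 := by
  rw [jumpRate, h]
  simp [Model.jumpExt]

theorem jumpRate_le {G : Adjoin S × Adjoin S → ℝ≥0∞} {C : ℝ≥0∞} {v : ℝ≥0} {ω : PathSpace S}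
    (h : ∀ a, ∫⁻ y, G (PathSpace.process v ω, Sum.inl y)
      ∂(M.jumpExt (PathSpace.process v ω) a) ≤ C) : π.jumpRate G v ω ≤ C := by
  have := π.isProbabilityMeasure v ω
  calc π.jumpRate G v ω ≤ ∫⁻ _, C ∂(π.prob v ω) := lintegral_mono h
    _ = C := by rw [lintegral_const, measure_univ, mul_one]

theorem measurable_jumpRate {G : Adjoin S × Adjoin S → ℝ≥0∞} (hG : Measurable G) :
    Measurable fun p : ℝ≥0 × PathSpace S => π.jumpRate G p.1 p.2 :=
  Measurable.lintegral_kernel_prod_right' (κ := π.probKernel)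
    (f := fun z => ∫⁻ y, G (PathSpace.process z.1.1 z.1.2, Sum.inl y)
      ∂(M.jumpExt (PathSpace.process z.1.1 z.1.2) z.2))
    ((M.measurable_lintegral_jumpExt hG).comp
      ((PathSpace.measurable_process.comp measurable_fst).prodMk measurable_snd))

theorem jumpRate_eq_lintegral_intensity {G : Adjoin S × Adjoin S → ℝ≥0∞} (hG : Measurable G)
    {k : ℕ} {ω : PathSpace S} {τ : ℝ≥0} {s : ℝ} (hs : 0 < s)
    (hτ : PathSpace.jumpTime k ω = τ) (h : ω ∈ PathSpace.sojourn k (τ + s.toNNReal)) :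
    π.jumpRate G (τ + s.toNNReal) ω
      = ∫⁻ y, G (PathSpace.state k ω, Sum.inl y) ∂(π.intensity k (PathSpace.hist k ω, s)) := by
  rw [π.lintegral_intensity k _ _ (f := fun y => G (PathSpace.state k ω, Sum.inl y))
      (hG.comp (measurable_const.prodMk measurable_inl)),
    π.histProb_hist hs hτ h.2.le, jumpRate, PathSpace.process_eq_state h]
  rfl

end JumpRate

section Compensator

variable {S A : Type*} [MeasurableSpace S] [MeasurableSpace A] [StandardBorelSpace S]
  {M : Model S A} (π : Policy M)

theorem lintegral_law_succ_eq_lintegral_intensity (γ : Measure S) [IsProbabilityMeasure γ] (k : ℕ)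
    {H : Hist S k × Mark S → ℝ≥0∞} (hH : Measurable H) (hH0 : ∀ h, H (h, cemetery S) = 0) :
    ∫⁻ ω, H (PathSpace.hist k ω, ω.1 (k + 1)) ∂(π.law γ)
      = ∫⁻ ω, (∫⁻ s in Ioi (0 : ℝ), {s : ℝ | ENNReal.ofReal s < (ω.1 (k + 1)).1}.indicator
          (fun s => ∫⁻ y, H (PathSpace.hist k ω, (ENNReal.ofReal s, Sum.inl y))
            ∂(π.intensity k (PathSpace.hist k ω, s))) s) ∂(π.law γ) := by
  have hΦ : Measurable fun p : Hist S k × ℝ =>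
      ∫⁻ y, H (p.1, (ENNReal.ofReal p.2, Sum.inl y)) ∂(π.intensity k p) :=
    Measurable.lintegral_kernel_prod_right' (κ := π.intensity k)
      (f := fun z => H (z.1.1, (ENNReal.ofReal z.1.2, Sum.inl z.2)))
      (hH.comp ((measurable_fst.comp measurable_fst).prodMk
        (measurable_jumpMark.comp ((measurable_snd.comp measurable_fst).prodMk measurable_snd))))
  have hset : MeasurableSet {p : (Hist S k × Mark S) × ℝ | ENNReal.ofReal p.2 < p.1.2.1} :=
    measurableSet_lt (ENNReal.measurable_ofReal.comp measurable_snd)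
      (measurable_fst.comp (measurable_snd.comp measurable_fst))
  rw [π.lintegral_law_succ γ k hH]
  simp_rw [fun h => π.lintegral_stepKernel_eq_lintegral_intensity k h
    (H := fun m => H (h, m)) (hH.comp measurable_prodMk_left) (hH0 h)]
  exact (π.lintegral_law_succ γ k (G := fun z => ∫⁻ s in Ioi (0 : ℝ),
    {s : ℝ | ENNReal.ofReal s < z.2.1}.indicator
      (fun s => ∫⁻ y, H (z.1, (ENNReal.ofReal s, Sum.inl y)) ∂(π.intensity k (z.1, s))) s)
    (Measurable.lintegral_prod_right' ((hΦ.comp ((measurable_fst.comp measurable_fst).prodMk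
      measurable_snd)).indicator hset))).symm

-- Substituting `v = T_k + s` turns the intensity after the `k`-th jump into the jump rate.
theorem lintegral_weightedJump_intensity (k : ℕ) (t : ℝ≥0) {G : Adjoin S × Adjoin S → ℝ≥0∞}
    (hG : Measurable G) (ω : PathSpace S) :
    ∫⁻ s in Ioi (0 : ℝ), {s : ℝ | ENNReal.ofReal s < (ω.1 (k + 1)).1}.indicator
        (fun s => ∫⁻ y, weightedJump k t G (PathSpace.hist k ω, (ENNReal.ofReal s, Sum.inl y))
          ∂(π.intensity k (PathSpace.hist k ω, s))) s
      = ∫⁻ v in Ioc (0 : ℝ) t,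
          (PathSpace.sojourn k v.toNNReal).indicator (π.jumpRate G v.toNNReal) ω := by
  by_cases hT : PathSpace.jumpTime k ω = ∞
  · simp [weightedJump, PathSpace.time_hist, PathSpace.sojourn, hT]
  lift PathSpace.jumpTime k ω to ℝ≥0 using hT with τ hτ
  rw [← lintegral_indicator measurableSet_Ioi, ← lintegral_indicator measurableSet_Ioc,
    ← lintegral_add_right_eq_self ((Ioc (0 : ℝ) t).indicator _) (τ : ℝ)]
  have hne : ∀ᵐ s : ℝ, s ≠ 0 := by simp [ae_iff]
  refine lintegral_congr_ae (hne.mono fun s hs => ?_)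
  rcases hs.lt_or_gt with hs | hs
  · rw [indicator_of_notMem (notMem_Ioi.2 hs.le), eq_comm, indicator_apply_eq_zero]
    refine fun hmem => indicator_of_notMem (fun hsoj => ?_) _
    have hle := hsoj.1
    rw [← hτ, ENNReal.coe_le_coe, Real.le_toNNReal_iff_coe_le hmem.1.le] at hle
    linarith
  have hadd : (s + τ).toNNReal = τ + s.toNNReal := by
    rw [Real.toNNReal_add hs.le τ.coe_nonneg, Real.toNNReal_coe, add_comm]
  have hle_t : (τ : ℝ≥0∞) + ENNReal.ofReal s ≤ t ↔ s + τ ∈ Ioc (0 : ℝ) t := by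
    rw [mem_Ioc, and_iff_right (add_pos_of_pos_of_nonneg hs τ.coe_nonneg),
      ← Real.toNNReal_le_iff_le_coe, hadd, ENNReal.ofReal, ← ENNReal.coe_add, ENNReal.coe_le_coe]
  have hsoj : ENNReal.ofReal s < (ω.1 (k + 1)).1 ↔ ω ∈ PathSpace.sojourn k (s + τ).toNNReal := by
    simp [hadd, PathSpace.sojourn, PathSpace.jumpTime_succ, ← hτ, ENNReal.ofReal]
  rw [indicator_of_mem (mem_Ioi.2 hs)]
  simp only [indicator, weightedJump, mem_ofPred_eq, PathSpace.time_hist, ← hτ, hle_t, hsoj]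
  split_ifs with _ _ hω
  · rw [hadd] at hω ⊢
    exact (π.jumpRate_eq_lintegral_intensity hG hs hτ.symm hω).symm
  all_goals simp_all

theorem lintegral_jump (γ : Measure S) [IsProbabilityMeasure γ] (k : ℕ)
    {G : Adjoin S × Adjoin S → ℝ≥0∞} (hG : Measurable G) (t : ℝ≥0) :
    ∫⁻ ω, {ω | PathSpace.jumpTime (k + 1) ω ≤ t}.indicator
        (fun ω => G (PathSpace.state k ω, PathSpace.state (k + 1) ω)) ω ∂(π.law γ)
      = ∫⁻ ω, (∫⁻ v in Ioc (0 : ℝ) t,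
          (PathSpace.sojourn k v.toNNReal).indicator (π.jumpRate G v.toNNReal) ω) ∂(π.law γ) := by
  have hcem : ∀ h : Hist S k, weightedJump k t G (h, cemetery S) = 0 := fun h =>
    indicator_of_notMem (by simp [cemetery]) _
  simp_rw [← weightedJump_hist, ← π.lintegral_weightedJump_intensity k t hG]
  exact π.lintegral_law_succ_eq_lintegral_intensity γ k (measurable_weightedJump k t hG) hcem

theorem lintegral_tsum_jump (γ : Measure S) [IsProbabilityMeasure γ]
    {G : Adjoin S × Adjoin S → ℝ≥0∞} (hG : Measurable G) (t : ℝ≥0) :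
    ∫⁻ ω, ∑' k, {ω | PathSpace.jumpTime (k + 1) ω ≤ t}.indicator
        (fun ω => G (PathSpace.state k ω, PathSpace.state (k + 1) ω)) ω ∂(π.law γ)
      = ∫⁻ ω, (∫⁻ v in Ioc (0 : ℝ) t, π.jumpRate G v.toNNReal ω) ∂(π.law γ) := by
  have hjump : ∀ k, Measurable ({ω : PathSpace S | PathSpace.jumpTime (k + 1) ω ≤ t}.indicator
      fun ω => G (PathSpace.state k ω, PathSpace.state (k + 1) ω)) := fun k =>
    (hG.comp ((PathSpace.measurable_state k).prodMk (PathSpace.measurable_state (k + 1)))).indicator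
      (measurableSet_le (PathSpace.measurable_jumpTime (k + 1)) measurable_const)
  have hrate : ∀ k, Measurable fun p : PathSpace S × ℝ =>
      (PathSpace.sojourn k p.2.toNNReal).indicator (π.jumpRate G p.2.toNNReal) p.1 := fun k =>
    ((π.measurable_jumpRate hG).indicator (PathSpace.measurableSet_prod_sojourn k)).comp
      (measurable_snd.real_toNNReal.prodMk measurable_fst)
  rw [lintegral_tsum fun k => (hjump k).aemeasurable]
  simp_rw [fun k => π.lintegral_jump γ k hG t]
  rw [← lintegral_tsum fun k => (Measurable.lintegral_prod_right' (hrate k)).aemeasurable]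
  refine lintegral_congr fun ω => ?_
  have hω : ∀ k, Measurable fun v : ℝ =>
      (PathSpace.sojourn k v.toNNReal).indicator (π.jumpRate G v.toNNReal) ω := fun k =>
    (hrate k).comp measurable_prodMk_left
  rw [← lintegral_tsum fun k => (hω k).aemeasurable]
  exact lintegral_congr fun v =>
    PathSpace.tsum_indicator_sojourn fun h => π.jumpRate_eq_zero G h

end Compensator

end Policy

section StoppedWeight

variable {S : Type*}

/-- The weight of the state after the `k`-th jump discounted at rate `c`, on the event that this
jump occurs by time `t`. -/
def discountedWeight (W : Adjoin S → ℝ≥0∞) (c : ℝ≥0) (t : ℝ≥0) (k : ℕ) : PathSpace S → ℝ≥0∞ :=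
  {ω | PathSpace.jumpTime k ω ≤ t}.indicator fun ω =>
    expNeg (c * PathSpace.jumpTime k ω) * W (PathSpace.state k ω)

/-- The weight of the state at time `min T_{k+1} t` discounted at rate `c`, on the event
`T_k ≤ t`, as a function of the history up to the `k`-th jump and the next mark. -/
def stoppedWeight (W : Adjoin S → ℝ≥0∞) (c t : ℝ≥0) (k : ℕ) : Hist S k × Mark S → ℝ≥0∞ :=
  {z : Hist S k × Mark S | z.1.time ≤ t}.indicator fun z =>
    if z.1.time + z.2.1 ≤ t then expNeg (c * (z.1.time + z.2.1)) * W z.2.2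
    else expNeg (c * t) * W z.1.last

theorem stoppedWeight_hist (W : Adjoin S → ℝ≥0∞) (c t : ℝ≥0) (k : ℕ) (ω : PathSpace S) :
    stoppedWeight W c t k (PathSpace.hist k ω, ω.1 (k + 1))
      = discountedWeight W c t (k + 1) ω + expNeg (c * t) *
        (PathSpace.sojourn k t).indicator (fun ω => W (PathSpace.state k ω)) ω := by
  have hmono : PathSpace.jumpTime k ω ≤ PathSpace.jumpTime (k + 1) ω :=
    PathSpace.jumpTime_mono ω k.le_succ
  simp only [stoppedWeight, discountedWeight, indicator, mem_ofPred_eq, PathSpace.time_hist,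
    ← PathSpace.jumpTime_succ, PathSpace.sojourn]
  by_cases hsucc : PathSpace.jumpTime (k + 1) ω ≤ t
  · simp only [hsucc, hmono.trans hsucc, not_lt.2 hsucc, and_false, if_true, if_false, mul_zero,
      add_zero]
    rfl
  · by_cases hk : PathSpace.jumpTime k ω ≤ t
    · simp only [hsucc, hk, not_le.1 hsucc, and_self, if_true, if_false, zero_add]
      rfl
    · simp only [hsucc, hk, false_and, if_false, mul_zero, add_zero]

theorem measurable_stoppedWeight [MeasurableSpace S] {W : Adjoin S → ℝ≥0∞} (hW : Measurable W)
    (c t : ℝ≥0) (k : ℕ) :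
    Measurable (stoppedWeight W c t k) := by
  have htime : Measurable fun z : Hist S k × Mark S => z.1.time :=
    (Hist.measurable_time k).comp measurable_fst
  have hjump : Measurable fun z : Hist S k × Mark S => z.1.time + z.2.1 :=
    htime.add (measurable_fst.comp measurable_snd)
  exact (((measurable_expNeg.comp (hjump.const_mul _)).mul
    (hW.comp (measurable_snd.comp measurable_snd))).ite (measurableSet_le hjump measurable_const)
      ((hW.comp ((Hist.measurable_last k).comp measurable_fst)).const_mul _)).indicator
    (measurableSet_le htime measurable_const)

end StoppedWeight

namespace Policy

section Growth

variable {S A : Type*} [MeasurableSpace S] [MeasurableSpace A] [StandardBorelSpace S]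
  {M : Model S A} (π : Policy M) {W : Adjoin S → ℝ≥0∞} {c : ℝ≥0}

theorem lintegral_intensity_le (hW : Measurable W) (hc : M.GrowthBound W c) (k : ℕ)
    (h : Hist S k) (s : ℝ) :
    ∫⁻ y, W (Sum.inl y) ∂(π.intensity k (h, s)) ≤ (π.intensity k (h, s) univ + c) * W h.last := by
  have hjump : Measurable fun a => M.jumpExt h.last a univ :=
    (Measure.measurable_coe MeasurableSet.univ).comp
      (M.measurable_jumpExt.comp measurable_prodMk_left)
  have huniv : π.intensity k (h, s) univ = ∫⁻ a, M.jumpExt h.last a univ ∂(π.histProb k h s) := by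
    simpa using π.lintegral_intensity k h s (f := fun _ => 1) measurable_const
  calc ∫⁻ y, W (Sum.inl y) ∂(π.intensity k (h, s))
      = ∫⁻ a, ∫⁻ y, W (Sum.inl y) ∂(M.jumpExt h.last a) ∂(π.histProb k h s) :=
        π.lintegral_intensity k h s (f := fun y => W (Sum.inl y)) (hW.comp measurable_inl)
    _ ≤ ∫⁻ a, (M.jumpExt h.last a univ + c) * W h.last ∂(π.histProb k h s) :=
        lintegral_mono fun a => hc h.last a
    _ = (π.intensity k (h, s) univ + c * π.histProb k h s univ) * W h.last := by
        rw [lintegral_mul_const _ (hjump.add_const _), lintegral_add_right _ measurable_const,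
          lintegral_const, huniv]
    _ ≤ (π.intensity k (h, s) univ + c) * W h.last := by
        gcongr
        exact mul_le_of_le_one_right zero_le (π.histProb_univ_le k h s)

theorem expNeg_lintegral_intensity_add (k : ℕ) (h : Hist S k) (c : ℝ≥0) (u : ℝ) :
    expNeg (∫⁻ v in Ioc 0 u, (π.intensity k (h, v) univ + c))
      = expNeg (π.cumIntensity k h u) * expNeg (c * ENNReal.ofReal u) := by
  rw [lintegral_add_right _ measurable_const, setLIntegral_const, Real.volume_Ioc, sub_zero,
    expNeg_add]
  rfl

-- The discount factor acts as an additional hazard rate `c`.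
theorem setLIntegral_stepKernel_expNeg_mul_le (hW : Measurable W) (hc : M.GrowthBound W c) (k : ℕ)
    (h : Hist S k) {r : ℝ} (hr : 0 ≤ r) :
    ∫⁻ m in {m | m.1 ≤ ENNReal.ofReal r}, expNeg (c * m.1) * W m.2 ∂(π.stepKernel k h)
      ≤ W h.last * ∫⁻ u in Ioc 0 r, expNeg (∫⁻ v in Ioc 0 u, (π.intensity k (h, v) univ + c))
        * (π.intensity k (h, u) univ + c) := by
  have hmono : Monotone fun u : ℝ => ∫⁻ v in Ioc 0 u, (π.intensity k (h, v) univ + c) :=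
    fun u u' huu' => lintegral_mono_set (Ioc_subset_Ioc_right huu')
  have hH : Measurable fun m : Mark S => expNeg (c * m.1) * W m.2 :=
    (measurable_expNeg.comp (measurable_fst.const_mul _)).mul (hW.comp measurable_snd)
  have hmeas : Measurable fun u : ℝ =>
      expNeg (∫⁻ v in Ioc 0 u, (π.intensity k (h, v) univ + c))
        * (π.intensity k (h, u) univ + c) :=
    (measurable_expNeg.comp hmono.measurable).mul ((π.measurable_intensity_univ k h).add_const _)
  rw [π.setLIntegral_stepKernel k h hH hr, ← lintegral_const_mul _ hmeas]
  refine lintegral_mono fun u => ?_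
  calc expNeg (π.cumIntensity k h u)
        * ∫⁻ y, expNeg (c * ENNReal.ofReal u) * W (Sum.inl y) ∂(π.intensity k (h, u))
      = expNeg (∫⁻ v in Ioc 0 u, (π.intensity k (h, v) univ + c))
          * ∫⁻ y, W (Sum.inl y) ∂(π.intensity k (h, u)) := by
        rw [lintegral_const_mul _ (f := fun y => W (Sum.inl y)) (hW.comp measurable_inl),
          π.expNeg_lintegral_intensity_add, mul_assoc]
    _ ≤ expNeg (∫⁻ v in Ioc 0 u, (π.intensity k (h, v) univ + c))
          * ((π.intensity k (h, u) univ + c) * W h.last) := by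
        gcongr
        exact π.lintegral_intensity_le hW hc k h u
    _ = W h.last * (expNeg (∫⁻ v in Ioc 0 u, (π.intensity k (h, v) univ + c))
          * (π.intensity k (h, u) univ + c)) := by ring

theorem setLIntegral_stepKernel_expNeg_mul_add_le (hW : Measurable W) (hc : M.GrowthBound W c)
    (k : ℕ) (h : Hist S k) (r : ℝ≥0) :
    ∫⁻ m in {m | m.1 ≤ r}, expNeg (c * m.1) * W m.2 ∂(π.stepKernel k h)
      + expNeg (c * r) * W h.last * π.stepKernel k h {m | r < m.1} ≤ W h.last := by
  obtain ⟨C, hC⟩ := π.intensity_bounded k h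
  have hhazard := lintegral_hazard_Ioc ((π.measurable_intensity_univ k h).add_const (c : ℝ≥0∞))
    (C := C + c) (fun v => by rw [ENNReal.coe_add]; exact add_le_add_left (hC v) _) r
  rw [← ENNReal.ofReal_coe_nnreal, π.stepKernel_lt k h r.coe_nonneg]
  calc _ ≤ W h.last * (∫⁻ u in Ioc (0 : ℝ) r,
          expNeg (∫⁻ v in Ioc 0 u, (π.intensity k (h, v) univ + c))
            * (π.intensity k (h, u) univ + c))
        + W h.last * expNeg (∫⁻ v in Ioc (0 : ℝ) r, (π.intensity k (h, v) univ + c)) := by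
        refine add_le_add (π.setLIntegral_stepKernel_expNeg_mul_le hW hc k h r.coe_nonneg)
          (le_of_eq ?_)
        rw [π.expNeg_lintegral_intensity_add]
        ring
    _ = W h.last := by rw [← mul_add, hhazard, mul_one]

theorem lintegral_stoppedWeight_le (hW : Measurable W) (hc : M.GrowthBound W c) {k : ℕ}
    {h : Hist S k} {t : ℝ≥0} (ht : h.time ≤ t) :
    ∫⁻ m, stoppedWeight W c t k (h, m) ∂(π.stepKernel k h) ≤ expNeg (c * h.time) * W h.last := by
  simp only [stoppedWeight, indicator, mem_ofPred_eq, ht, if_true]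
  lift h.time to ℝ≥0 using ne_top_of_le_ne_top ENNReal.coe_ne_top ht with τ hτ
  obtain ⟨r, rfl⟩ := exists_add_of_le (ENNReal.coe_le_coe.1 ht)
  have hset : MeasurableSet {m : Mark S | m.1 ≤ r} :=
    measurableSet_le measurable_fst measurable_const
  have hiff : ∀ m : Mark S, τ + m.1 ≤ (τ + r : ℝ≥0) ↔ m.1 ≤ r := fun m => by
    rw [ENNReal.coe_add, ENNReal.add_le_add_iff_left ENNReal.coe_ne_top]
  have hcompl : {m : Mark S | m.1 ≤ r}ᶜ = {m | (r : ℝ≥0∞) < m.1} := by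
    ext m
    simp
  have hH : Measurable fun m : Mark S => expNeg (c * m.1) * W m.2 :=
    (measurable_expNeg.comp (measurable_fst.const_mul _)).mul (hW.comp measurable_snd)
  simp only [hiff]
  simp only [ENNReal.coe_add, mul_add, expNeg_add, mul_assoc]
  rw [← lintegral_add_compl _ hset,
    setLIntegral_congr_fun (g := fun m => expNeg (c * τ) * (expNeg (c * m.1) * W m.2)) hset
      (fun _ hm => by exact if_pos hm),
    setLIntegral_congr_fun (g := fun _ => expNeg (c * τ) * (expNeg (c * r) * W h.last)) hset.compl
      (fun _ hm => by exact if_neg hm),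
    lintegral_const_mul _ hH, setLIntegral_const, hcompl, mul_assoc, ← mul_add]
  gcongr
  exact π.setLIntegral_stepKernel_expNeg_mul_add_le hW hc k h r

variable (γ : Measure S) [IsProbabilityMeasure γ]

theorem lintegral_discountedWeight_succ_le (hW : Measurable W) (hc : M.GrowthBound W c) (t : ℝ≥0)
    (k : ℕ) :
    ∫⁻ ω, discountedWeight W c t (k + 1) ω ∂(π.law γ)
      + expNeg (c * t) * ∫⁻ ω, (PathSpace.sojourn k t).indicator
        (fun ω => W (PathSpace.state k ω)) ω ∂(π.law γ)
      ≤ ∫⁻ ω, discountedWeight W c t k ω ∂(π.law γ) := by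
  have hsoj : Measurable ((PathSpace.sojourn k t).indicator fun ω => W (PathSpace.state k ω)) :=
    (hW.comp (PathSpace.measurable_state k)).indicator (PathSpace.measurableSet_sojourn k t)
  rw [← lintegral_const_mul _ hsoj, ← lintegral_add_right _ (hsoj.const_mul _)]
  simp_rw [← stoppedWeight_hist]
  rw [π.lintegral_law_succ γ k (measurable_stoppedWeight hW c t k)]
  refine lintegral_mono fun ω => ?_
  by_cases hk : PathSpace.jumpTime k ω ≤ t
  · rw [discountedWeight,
      indicator_of_mem (s := {ω : PathSpace S | PathSpace.jumpTime k ω ≤ t}) hk,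
      ← PathSpace.time_hist]
    exact π.lintegral_stoppedWeight_le hW hc ((PathSpace.time_hist k ω).trans_le hk)
  · have hzero : ∀ m, stoppedWeight W c t k (PathSpace.hist k ω, m) = 0 := fun m =>
      indicator_of_notMem (by simpa [PathSpace.time_hist] using hk) _
    simp only [hzero, lintegral_zero, zero_le]

theorem lintegral_discountedWeight_add_sum_le (hW : Measurable W) (hc : M.GrowthBound W c)
    (t : ℝ≥0) (n : ℕ) :
    ∫⁻ ω, discountedWeight W c t n ω ∂(π.law γ)
      + expNeg (c * t) * ∑ k ∈ Finset.range n, ∫⁻ ω, (PathSpace.sojourn k t).indicator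
        (fun ω => W (PathSpace.state k ω)) ω ∂(π.law γ)
      ≤ ∫⁻ x, W (Sum.inl x) ∂γ := by
  induction n with
  | zero =>
    rw [Finset.range_zero, Finset.sum_empty, mul_zero, add_zero,
      ← π.lintegral_law_zero γ (G := fun m => W m.2) (hW.comp measurable_snd)]
    refine lintegral_mono fun ω => (indicator_le_self _ _ _).trans_eq ?_
    rw [PathSpace.jumpTime_zero, mul_zero, expNeg_zero, one_mul]
    rfl
  | succ n ih =>
    rw [Finset.sum_range_succ, add_comm (∑ k ∈ Finset.range n, _), mul_add, ← add_assoc]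
    exact (add_le_add_left (π.lintegral_discountedWeight_succ_le γ hW hc t n) _).trans ih

theorem expNeg_mul_lintegral_state_le (hW : Measurable W) (hc : M.GrowthBound W c) (t : ℝ≥0)
    (n : ℕ) :
    expNeg (c * t) * ∫⁻ ω, {ω | PathSpace.jumpTime n ω ≤ t}.indicator
        (fun ω => W (PathSpace.state n ω)) ω ∂(π.law γ) ≤ ∫⁻ x, W (Sum.inl x) ∂γ := by
  have hmeas : Measurable ({ω : PathSpace S | PathSpace.jumpTime n ω ≤ t}.indicator
      fun ω => W (PathSpace.state n ω)) :=
    (hW.comp (PathSpace.measurable_state n)).indicator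
      (measurableSet_le (PathSpace.measurable_jumpTime n) measurable_const)
  rw [← lintegral_const_mul _ hmeas]
  refine (lintegral_mono fun ω => ?_).trans
    (le_self_add.trans (π.lintegral_discountedWeight_add_sum_le γ hW hc t n))
  by_cases hk : PathSpace.jumpTime n ω ≤ t
  · simp only [discountedWeight, indicator, mem_ofPred_eq, hk, if_true]
    gcongr
    exact expNeg_anti (by gcongr)
  · simp [discountedWeight, hk]

theorem expNeg_mul_lintegral_process_le (hW : Measurable W) (hW0 : W (Sum.inr ()) = 0)
    (hc : M.GrowthBound W c) (t : ℝ≥0) :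
    expNeg (c * t) * ∫⁻ ω, W (PathSpace.process t ω) ∂(π.law γ) ≤ ∫⁻ x, W (Sum.inl x) ∂γ := by
  have hsoj : ∀ k, Measurable
      ((PathSpace.sojourn k t).indicator fun ω => W (PathSpace.state k ω)) := fun k =>
    (hW.comp (PathSpace.measurable_state k)).indicator (PathSpace.measurableSet_sojourn k t)
  have hprocess : ∀ ω, W (PathSpace.process t ω)
      = ∑' k, (PathSpace.sojourn k t).indicator (fun ω => W (PathSpace.state k ω)) ω := fun ω => by
    rw [← PathSpace.tsum_indicator_sojourn (f := fun ω => W (PathSpace.process t ω)) (t := t)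
      fun h => by rw [h, hW0]]
    exact tsum_congr fun k => congrFun (indicator_congr fun ω hω => by
      rw [PathSpace.process_eq_state hω]) ω
  simp_rw [hprocess]
  rw [lintegral_tsum fun k => (hsoj k).aemeasurable, ← ENNReal.tsum_mul_left]
  refine ENNReal.tsum_le_of_sum_range_le fun n => ?_
  rw [← Finset.mul_sum]
  exact le_add_self.trans (π.lintegral_discountedWeight_add_sum_le γ hW hc t n)

theorem lintegral_process_ne_top (hW : Measurable W) (hW0 : W (Sum.inr ()) = 0)
    (hc : M.GrowthBound W c) (t : ℝ≥0) (hγ : ∫⁻ x, W (Sum.inl x) ∂γ ≠ ∞) :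
    ∫⁻ ω, W (PathSpace.process t ω) ∂(π.law γ) ≠ ∞ := fun h => by
  have hbound := π.expNeg_mul_lintegral_process_le γ hW hW0 hc t
  have hexp : expNeg (c * t) ≠ 0 :=
    expNeg_ne_zero (ENNReal.mul_ne_top ENNReal.coe_ne_top ENNReal.coe_ne_top)
  rw [h, ENNReal.mul_top hexp, top_le_iff] at hbound
  exact hγ hbound

end Growth

end Policy

section Nonexplosion

variable {S A : Type*} [MeasurableSpace S] [MeasurableSpace A] {M : Model S A}

theorem Model.IsLyapunov.bddAbove_maxRate_sublevel {w : S → ℝ} (hw : M.IsLyapunov w) (R : ℝ) :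
    BddAbove (M.maxRate '' {x | w x ≤ R}) := by
  obtain ⟨ρ, b, Sl, _, _, _, _, _, hlim, _, hrate⟩ := hw.exists_bounds
  obtain ⟨l, hl⟩ := (hlim.eventually (lt_mem_nhds (EReal.coe_lt_top R))).exists
  have hsub : {x | w x ≤ R} ⊆ Sl l := fun x hx => by
    by_contra hxl
    have hinf : ⨅ y ∈ (Sl l)ᶜ, (w y : EReal) ≤ w x := iInf₂_le x hxl
    exact absurd (hl.trans_le hinf) (not_lt.2 (EReal.coe_le_coe_iff.2 hx))
  exact (hrate l).mono (image_mono hsub)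

namespace Policy

variable [StandardBorelSpace S] (π : Policy M) (γ : Measure S) [IsProbabilityMeasure γ]

theorem ae_tsum_jump_ne_top {B : Set S} (hB : MeasurableSet B) (hrate : BddAbove (M.maxRate '' B))
    (t : ℝ≥0) :
    ∀ᵐ ω ∂(π.law γ), ∑' k, {ω | PathSpace.jumpTime (k + 1) ω ≤ t}.indicator
      (fun ω => (Sum.inl '' B).indicator (fun _ => (1 : ℝ≥0∞)) (PathSpace.state k ω)) ω ≠ ∞ := by
  obtain ⟨C, hC⟩ := hrate
  have hone : Measurable ((Sum.inl '' B).indicator fun _ : Adjoin S => (1 : ℝ≥0∞)) :=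
    measurable_const.indicator hB.inl_image
  have hbound : ∀ z a, ∫⁻ _, (Sum.inl '' B).indicator (fun _ => (1 : ℝ≥0∞)) z ∂(M.jumpExt z a)
      ≤ ENNReal.ofReal C := fun z a => by
    rw [lintegral_const]
    by_cases hz : z ∈ Sum.inl '' B
    · obtain ⟨y, hy, rfl⟩ := hz
      rw [indicator_of_mem (mem_image_of_mem _ hy), one_mul]
      exact (M.jumpExt_univ_le _ a).trans (ENNReal.ofReal_le_ofReal (hC ⟨y, hy, rfl⟩))
    · simp [hz]
  have hmeas : ∀ k, Measurable ({ω : PathSpace S | PathSpace.jumpTime (k + 1) ω ≤ t}.indicator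
      fun ω => (Sum.inl '' B).indicator (fun _ => (1 : ℝ≥0∞)) (PathSpace.state k ω)) := fun k =>
    (hone.comp (PathSpace.measurable_state k)).indicator
      (measurableSet_le (PathSpace.measurable_jumpTime (k + 1)) measurable_const)
  refine (ae_lt_top (Measurable.tsum hmeas) ?_).mono fun ω => ne_of_lt
  rw [π.lintegral_tsum_jump γ (G := fun p => (Sum.inl '' B).indicator (fun _ => 1) p.1)
    (hone.comp measurable_fst) t]
  refine ne_top_of_le_ne_top ?_ (lintegral_mono fun ω => lintegral_mono fun v =>
    π.jumpRate_le (hbound _))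
  simp [ENNReal.mul_eq_top]

theorem ae_liminf_state_lt_top {W : Adjoin S → ℝ≥0∞} {c : ℝ≥0} (hW : Measurable W)
    (hc : M.GrowthBound W c) (hγ : ∫⁻ x, W (Sum.inl x) ∂γ ≠ ∞) (t : ℝ≥0) :
    ∀ᵐ ω ∂(π.law γ), liminf (fun n => {ω | PathSpace.jumpTime n ω ≤ t}.indicator
      (fun ω => W (PathSpace.state n ω)) ω) atTop < ∞ := by
  have hmeas : ∀ n, Measurable ({ω : PathSpace S | PathSpace.jumpTime n ω ≤ t}.indicator
      fun ω => W (PathSpace.state n ω)) := fun n =>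
    (hW.comp (PathSpace.measurable_state n)).indicator
      (measurableSet_le (PathSpace.measurable_jumpTime n) measurable_const)
  have hexp : expNeg (c * t) ≠ 0 :=
    expNeg_ne_zero (ENNReal.mul_ne_top ENNReal.coe_ne_top ENNReal.coe_ne_top)
  have hbound : ∀ n, ∫⁻ ω, {ω | PathSpace.jumpTime n ω ≤ t}.indicator
      (fun ω => W (PathSpace.state n ω)) ω ∂(π.law γ)
      ≤ (∫⁻ x, W (Sum.inl x) ∂γ) / expNeg (c * t) := fun n =>
    (ENNReal.le_div_iff_mul_le (Or.inl hexp) (Or.inr hγ)).2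
      ((mul_comm _ _).trans_le (π.expNeg_mul_lintegral_state_le γ hW hc t n))
  refine ae_lt_top (Measurable.liminf hmeas) (ne_top_of_le_ne_top (ENNReal.div_ne_top hγ hexp) ?_)
  exact (lintegral_liminf_le hmeas).trans
    (liminf_le_of_frequently_le' (Frequently.of_forall hbound))

theorem ae_exists_mem_sojourn {w : S → ℝ} (hw : M.IsLyapunov w) (hγ : Integrable w γ) (t : ℝ≥0) :
    ∀ᵐ ω ∂(π.law γ), ∃ m, ω ∈ PathSpace.sojourn m t := by
  obtain ⟨c, hc⟩ := hw.exists_growthBound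
  have hvisits := ae_all_iff.2 fun N : ℕ => π.ae_tsum_jump_ne_top γ
    (measurableSet_le hw.measurable measurable_const) (hw.bddAbove_maxRate_sublevel N) t
  filter_upwards [hvisits, π.ae_liminf_state_lt_top γ (measurable_ennExt hw.measurable) hc
    hγ.lintegral_lt_top.ne t] with ω hvisit hliminf
  by_contra! hexplode
  have htime := PathSpace.jumpTime_le_of_notMem_sojourn hexplode
  simp only [indicator, mem_ofPred_eq, htime, if_true] at hvisit hliminf
  obtain ⟨N, hN⟩ := ENNReal.exists_nat_gt hliminf.ne
  have hlow : ∃ᶠ n in atTop, ennExt w (PathSpace.state n ω) < N :=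
    frequently_lt_of_liminf_lt (by isBoundedDefault) hN
  have hleave := (ENNReal.tendsto_atTop_zero_of_tsum_ne_top (hvisit N)).eventually
    (gt_mem_nhds zero_lt_one)
  obtain ⟨n, hn, hn'⟩ := (hlow.and_eventually hleave).exists
  obtain ⟨y, hy⟩ := PathSpace.state_mem_range_inl (ne_top_of_le_ne_top ENNReal.coe_ne_top (htime n))
  rw [← hy, ennExt_inl, ← ENNReal.ofReal_natCast] at hn
  have hyN : y ∈ {x | w x ≤ N} := (ENNReal.ofReal_lt_ofReal_iff'.1 hn).1.le
  rw [← hy, if_pos (mem_image_of_mem _ hyN)] at hn'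
  exact lt_irrefl _ hn'

theorem law_process_mem_range_inl {w : S → ℝ} (hw : M.IsLyapunov w) (hγ : Integrable w γ)
    (t : ℝ≥0) : π.law γ {ω | PathSpace.process t ω ∈ range Sum.inl} = 1 := by
  have hmeas : MeasurableSet {ω : PathSpace S | PathSpace.process t ω ∈ range Sum.inl} :=
    (PathSpace.measurable_process.comp measurable_prodMk_left) measurableSet_range_inl
  rw [← mem_ae_iff_prob_eq_one hmeas]
  filter_upwards [π.ae_exists_mem_sojourn γ hw hγ t] with ω hω
  obtain ⟨m, hm⟩ := hω
  exact PathSpace.process_mem_range_inl hm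

end Policy

end Nonexplosion

section SecondWeight

variable {S A : Type*} [MeasurableSpace S] [MeasurableSpace A] [StandardBorelSpace S]
  {M : Model S A}

namespace Model

theorem JumpBounded.integrable_toReal {G : Adjoin S × Adjoin S → ℝ≥0∞} {W : Adjoin S → ℝ≥0∞}
    (hG : Measurable G) (h : M.JumpBounded G W) {z : Adjoin S} (hz : W z ≠ ∞)
    (μ : Measure (Adjoin A)) [IsFiniteMeasure μ] :
    Integrable (fun a => (∫⁻ y, G (z, Sum.inl y) ∂(M.jumpExt z a)).toReal) μ := by
  obtain ⟨K, hK⟩ := h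
  refine integrable_toReal_of_lintegral_ne_top
    ((M.measurable_lintegral_jumpExt hG).comp measurable_prodMk_left).aemeasurable ?_
  refine ne_top_of_le_ne_top ?_ (lintegral_mono (hK z))
  rw [lintegral_const]
  exact ENNReal.mul_ne_top (ENNReal.mul_ne_top ENNReal.coe_ne_top hz) (measure_ne_top μ univ)

namespace IsSecondWeight

variable {w w' u : S → ℝ}

theorem integrable_generator (hw' : M.IsSecondWeight w w') (hu : WeightedBounded w' u)
    (z : Adjoin S) (μ : Measure (Adjoin A)) [IsFiniteMeasure μ] :
    Integrable (M.generator u z) μ := by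
  refine WeightedBounded.induction_sub (P := fun v => Integrable (M.generator v z) μ)
    hw'.one_le hu (fun v hv hv0 => ?_) fun v₁ v₂ hv₁ hv₂ h₁ h₂ => ?_
  · refine Integrable.congr ?_ (ae_of_all _ fun a =>
      (generator_of_nonneg (hw'.integrable_jump hv) hv0 z a).symm)
    exact ((hw'.jumpBounded_ennExt_snd hv).integrable_toReal
      ((measurable_ennExt hv.1).comp measurable_snd) (ennExt_ne_top w z) μ).sub
      ((hw'.jumpBounded_ennExt_fst hv).integrable_toReal
      ((measurable_ennExt hv.1).comp measurable_fst) (ennExt_ne_top w z) μ)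
  · exact (h₁.sub h₂).congr (ae_of_all _ fun a =>
      (generator_sub (hw'.integrable_jump hv₁) (hw'.integrable_jump hv₂) z a).symm)

variable {X : Type*} [MeasurableSpace X] {μ : Measure X} {ξ : X → Adjoin S}

theorem lintegral_ennExt_comp_ne_top (hw' : M.IsSecondWeight w w') (hu : WeightedBounded w' u)
    (hξ : ∫⁻ ω, ennExt w (ξ ω) ∂μ ≠ ∞) : ∫⁻ ω, ennExt u (ξ ω) ∂μ ≠ ∞ := by
  obtain ⟨K, hK⟩ := hw'.exists_ennExt_le hu
  refine ne_top_of_le_ne_top ?_ (lintegral_mono fun ω => hK (ξ ω))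
  rw [lintegral_const_mul' _ _ ENNReal.coe_ne_top]
  exact ENNReal.mul_ne_top ENNReal.coe_ne_top hξ

theorem integrable_extendZero_comp (hw' : M.IsSecondWeight w w') (hu : WeightedBounded w' u)
    (hξm : Measurable ξ) (hξ : ∫⁻ ω, ennExt w (ξ ω) ∂μ ≠ ∞) :
    Integrable (fun ω => extendZero u (ξ ω)) μ := by
  refine ⟨((measurable_extendZero hu.1).comp hξm).aestronglyMeasurable, ?_⟩
  simp_rw [HasFiniteIntegral, enorm_extendZero]
  exact (hw'.lintegral_ennExt_comp_ne_top hu.abs hξ).lt_top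

end IsSecondWeight

end Model

end SecondWeight

theorem PathSpace.measurable_prod_process {S : Type*} [MeasurableSpace S] :
    Measurable fun p : PathSpace S × ℝ => process p.2.toNNReal p.1 :=
  measurable_process.comp (measurable_snd.real_toNNReal.prodMk measurable_fst)

namespace Policy

section Dynkin

variable {S A : Type*} [MeasurableSpace S] [MeasurableSpace A] [StandardBorelSpace S]
  {M : Model S A} (π : Policy M)

theorem integral_toReal_lintegral_jumpExt {G : Adjoin S × Adjoin S → ℝ≥0∞}
    {W : Adjoin S → ℝ≥0∞} (hG : Measurable G) (h : M.JumpBounded G W) {v : ℝ≥0} {ω : PathSpace S}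
    (hz : W (PathSpace.process v ω) ≠ ∞) :
    ∫ a, (∫⁻ y, G (PathSpace.process v ω, Sum.inl y)
      ∂(M.jumpExt (PathSpace.process v ω) a)).toReal ∂(π.prob v ω)
      = (π.jumpRate G v ω).toReal := by
  obtain ⟨K, hK⟩ := h
  exact integral_toReal
    ((M.measurable_lintegral_jumpExt hG).comp measurable_prodMk_left).aemeasurable
    (ae_of_all _ fun a => (hK _ a).trans_lt (ENNReal.mul_lt_top ENNReal.coe_lt_top hz.lt_top))

theorem drift_of_nonneg {w w' u : S → ℝ} (hw' : M.IsSecondWeight w w') (hu : WeightedBounded w' u)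
    (hu0 : ∀ x, 0 ≤ u x) (v : ℝ≥0) (ω : PathSpace S) :
    π.drift u v ω = (π.jumpRate (fun p => ennExt u p.2) v ω).toReal
      - (π.jumpRate (fun p => ennExt u p.1) v ω).toReal := by
  have := π.isProbabilityMeasure v ω
  have hfst : Measurable fun p : Adjoin S × Adjoin S => ennExt u p.1 :=
    (measurable_ennExt hu.1).comp measurable_fst
  have hsnd : Measurable fun p : Adjoin S × Adjoin S => ennExt u p.2 :=
    (measurable_ennExt hu.1).comp measurable_snd
  have hz := ennExt_ne_top w (PathSpace.process v ω)
  rw [← π.integral_toReal_lintegral_jumpExt hsnd (hw'.jumpBounded_ennExt_snd hu) hz,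
    ← π.integral_toReal_lintegral_jumpExt hfst (hw'.jumpBounded_ennExt_fst hu) hz,
    ← integral_sub ((hw'.jumpBounded_ennExt_snd hu).integrable_toReal hsnd hz _)
      ((hw'.jumpBounded_ennExt_fst hu).integrable_toReal hfst hz _)]
  exact integral_congr_ae (ae_of_all _ (Model.generator_of_nonneg (hw'.integrable_jump hu) hu0 _))

theorem drift_sub {w w' u₁ u₂ : S → ℝ} (hw' : M.IsSecondWeight w w')
    (hu₁ : WeightedBounded w' u₁) (hu₂ : WeightedBounded w' u₂) (v : ℝ≥0) (ω : PathSpace S) :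
    π.drift (u₁ - u₂) v ω = π.drift u₁ v ω - π.drift u₂ v ω := by
  have := π.isProbabilityMeasure v ω
  rw [drift, drift, drift, ← integral_sub (hw'.integrable_generator hu₁ _ _)
    (hw'.integrable_generator hu₂ _ _)]
  exact integral_congr_ae (ae_of_all _
    (Model.generator_sub (hw'.integrable_jump hu₁) (hw'.integrable_jump hu₂) _))

theorem measurable_prod_jumpRate {G : Adjoin S × Adjoin S → ℝ≥0∞} (hG : Measurable G) :
    Measurable fun p : PathSpace S × ℝ => π.jumpRate G p.2.toNNReal p.1 :=
  (π.measurable_jumpRate hG).comp (measurable_snd.real_toNNReal.prodMk measurable_fst)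

variable (γ : Measure S) [IsProbabilityMeasure γ]

theorem lintegral_process_add_lintegral_jumpRate {t : ℝ≥0}
    (hne : ∀ᵐ ω ∂(π.law γ), ∃ m, ω ∈ PathSpace.sojourn m t)
    {f : Adjoin S → ℝ≥0∞} (hf : Measurable f) :
    ∫⁻ ω, f (PathSpace.process t ω) ∂(π.law γ)
        + ∫⁻ p : PathSpace S × ℝ, π.jumpRate (fun p => f p.1) p.2.toNNReal p.1
          ∂((π.law γ).prod (volume.restrict (Ioc 0 (t : ℝ))))
      = ∫⁻ x, f (Sum.inl x) ∂γ
        + ∫⁻ p : PathSpace S × ℝ, π.jumpRate (fun p => f p.2) p.2.toNNReal p.1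
          ∂((π.law γ).prod (volume.restrict (Ioc 0 (t : ℝ)))) := by
  have hfst : Measurable fun p : Adjoin S × Adjoin S => f p.1 := hf.comp measurable_fst
  have hsnd : Measurable fun p : Adjoin S × Adjoin S => f p.2 := hf.comp measurable_snd
  have hprocess : Measurable fun ω : PathSpace S => f (PathSpace.process t ω) :=
    hf.comp (PathSpace.measurable_process.comp measurable_prodMk_left)
  have hstart : ∫⁻ x, f (Sum.inl x) ∂γ = ∫⁻ ω, f (PathSpace.state 0 ω) ∂(π.law γ) :=
    (π.lintegral_law_zero γ (G := fun p => f p.2) (hf.comp measurable_snd)).symm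
  have hstate : Measurable fun ω : PathSpace S => f (PathSpace.state 0 ω) :=
    hf.comp (PathSpace.measurable_state 0)
  rw [hstart, lintegral_prod _ (π.measurable_prod_jumpRate hfst).aemeasurable,
    lintegral_prod _ (π.measurable_prod_jumpRate hsnd).aemeasurable,
    ← π.lintegral_tsum_jump γ hfst t, ← π.lintegral_tsum_jump γ hsnd t,
    ← lintegral_add_left hprocess, ← lintegral_add_left hstate]
  refine lintegral_congr_ae (hne.mono fun ω hω => ?_)
  obtain ⟨m, hm⟩ := hω
  exact PathSpace.add_tsum_state_eq_add_tsum_state_succ hm f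

section Integrability

variable {w w' u : S → ℝ}

theorem lintegral_ennExt_process_ne_top (hw : M.IsLyapunov w) (hγ : Integrable w γ) (t : ℝ≥0) :
    ∫⁻ ω, ennExt w (PathSpace.process t ω) ∂(π.law γ) ≠ ∞ := by
  obtain ⟨c, hc⟩ := hw.exists_growthBound
  exact π.lintegral_process_ne_top γ (measurable_ennExt hw.measurable) rfl hc t
    hγ.lintegral_lt_top.ne

theorem lintegral_prod_ennExt_process_ne_top (hw : M.IsLyapunov w) (hγ : Integrable w γ)
    (t : ℝ≥0) :
    ∫⁻ p : PathSpace S × ℝ, ennExt w (PathSpace.process p.2.toNNReal p.1)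
      ∂((π.law γ).prod (volume.restrict (Ioc 0 (t : ℝ)))) ≠ ∞ := by
  obtain ⟨c, hc⟩ := hw.exists_growthBound
  have hW := measurable_ennExt hw.measurable
  have hstart : ∫⁻ x, ennExt w (Sum.inl x) ∂γ ≠ ∞ := hγ.lintegral_lt_top.ne
  have hexp : expNeg (c * t) ≠ 0 :=
    expNeg_ne_zero (ENNReal.mul_ne_top ENNReal.coe_ne_top ENNReal.coe_ne_top)
  have hbound : ∀ v ∈ Ioc 0 (t : ℝ), ∫⁻ ω, ennExt w (PathSpace.process v.toNNReal ω) ∂(π.law γ)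
      ≤ (∫⁻ x, ennExt w (Sum.inl x) ∂γ) / expNeg (c * t) := fun v hv => by
    rw [ENNReal.le_div_iff_mul_le (Or.inl hexp) (Or.inr hstart), mul_comm]
    refine le_trans ?_ (π.expNeg_mul_lintegral_process_le γ hW rfl hc v.toNNReal)
    gcongr
    exact expNeg_anti (mul_le_mul_right
      (ENNReal.coe_le_coe.2 (Real.toNNReal_le_iff_le_coe.2 hv.2)) _)
  have hprocess : Measurable fun p : PathSpace S × ℝ =>
      ennExt w (PathSpace.process p.2.toNNReal p.1) := hW.comp PathSpace.measurable_prod_process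
  rw [lintegral_prod_symm' _ hprocess]
  refine ne_top_of_le_ne_top ?_ (setLIntegral_mono' measurableSet_Ioc hbound)
  rw [setLIntegral_const, Real.volume_Ioc]
  exact ENNReal.mul_ne_top (ENNReal.div_ne_top hstart hexp) ENNReal.ofReal_ne_top

theorem lintegral_prod_jumpRate_ne_top (hw : M.IsLyapunov w) (hγ : Integrable w γ)
    {G : Adjoin S × Adjoin S → ℝ≥0∞} (hG : M.JumpBounded G (ennExt w)) (t : ℝ≥0) :
    ∫⁻ p : PathSpace S × ℝ, π.jumpRate G p.2.toNNReal p.1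
      ∂((π.law γ).prod (volume.restrict (Ioc 0 (t : ℝ)))) ≠ ∞ := by
  obtain ⟨K, hK⟩ := hG
  refine ne_top_of_le_ne_top ?_ (lintegral_mono fun p => π.jumpRate_le (hK _))
  rw [lintegral_const_mul' _ _ ENNReal.coe_ne_top]
  exact ENNReal.mul_ne_top ENNReal.coe_ne_top (π.lintegral_prod_ennExt_process_ne_top γ hw hγ t)

theorem integrable_process (hw : M.IsLyapunov w) (hw' : M.IsSecondWeight w w')
    (hγ : Integrable w γ) (hu : WeightedBounded w' u) (t : ℝ≥0) :
    Integrable (fun ω => extendZero u (PathSpace.process t ω)) (π.law γ) :=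
  hw'.integrable_extendZero_comp hu (PathSpace.measurable_process.comp measurable_prodMk_left)
    (π.lintegral_ennExt_process_ne_top γ hw hγ t)

theorem integrable_prod_process (hw : M.IsLyapunov w) (hw' : M.IsSecondWeight w w')
    (hγ : Integrable w γ) (hu : WeightedBounded w' u) (t : ℝ≥0) :
    Integrable (fun p : PathSpace S × ℝ => extendZero u (PathSpace.process p.2.toNNReal p.1))
      ((π.law γ).prod (volume.restrict (Ioc 0 (t : ℝ)))) :=
  hw'.integrable_extendZero_comp hu PathSpace.measurable_prod_process
    (π.lintegral_prod_ennExt_process_ne_top γ hw hγ t)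

theorem integrable_prod_jumpRate (hw : M.IsLyapunov w) (hγ : Integrable w γ)
    {G : Adjoin S × Adjoin S → ℝ≥0∞} (hG : Measurable G) (hGw : M.JumpBounded G (ennExt w))
    (t : ℝ≥0) :
    Integrable (fun p : PathSpace S × ℝ => (π.jumpRate G p.2.toNNReal p.1).toReal)
      ((π.law γ).prod (volume.restrict (Ioc 0 (t : ℝ)))) :=
  integrable_toReal_of_lintegral_ne_top (π.measurable_prod_jumpRate hG).aemeasurable
    (π.lintegral_prod_jumpRate_ne_top γ hw hγ hGw t)

theorem integrable_prod_drift (hw : M.IsLyapunov w) (hw' : M.IsSecondWeight w w')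
    (hγ : Integrable w γ) (hu : WeightedBounded w' u) (t : ℝ≥0) :
    Integrable (fun p : PathSpace S × ℝ => π.drift u p.2.toNNReal p.1)
      ((π.law γ).prod (volume.restrict (Ioc 0 (t : ℝ)))) := by
  refine WeightedBounded.induction_sub (P := fun v => Integrable
    (fun p : PathSpace S × ℝ => π.drift v p.2.toNNReal p.1) _) hw'.one_le hu
    (fun v hv hv0 => ?_) fun v₁ v₂ hv₁ hv₂ h₁ h₂ => ?_
  · simp_rw [π.drift_of_nonneg hw' hv hv0]
    exact (π.integrable_prod_jumpRate γ hw hγ ((measurable_ennExt hv.1).comp measurable_snd)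
      (hw'.jumpBounded_ennExt_snd hv) t).sub (π.integrable_prod_jumpRate γ hw hγ
      ((measurable_ennExt hv.1).comp measurable_fst) (hw'.jumpBounded_ennExt_fst hv) t)
  · simp_rw [π.drift_sub hw' hv₁ hv₂]
    exact h₁.sub h₂

end Integrability

section Formula

variable {w w' u : S → ℝ}

theorem integral_prod_drift_of_nonneg (hw : M.IsLyapunov w) (hw' : M.IsSecondWeight w w')
    (hγ : Integrable w γ) (hu : WeightedBounded w' u) (hu0 : ∀ x, 0 ≤ u x) (t : ℝ≥0) :
    ∫ p : PathSpace S × ℝ, π.drift u p.2.toNNReal p.1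
        ∂((π.law γ).prod (volume.restrict (Ioc 0 (t : ℝ))))
      = (∫⁻ p : PathSpace S × ℝ, π.jumpRate (fun p => ennExt u p.2) p.2.toNNReal p.1
          ∂((π.law γ).prod (volume.restrict (Ioc 0 (t : ℝ))))).toReal
        - (∫⁻ p : PathSpace S × ℝ, π.jumpRate (fun p => ennExt u p.1) p.2.toNNReal p.1
          ∂((π.law γ).prod (volume.restrict (Ioc 0 (t : ℝ))))).toReal := by
  have hfst : Measurable fun p : Adjoin S × Adjoin S => ennExt u p.1 :=
    (measurable_ennExt hu.1).comp measurable_fst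
  have hsnd : Measurable fun p : Adjoin S × Adjoin S => ennExt u p.2 :=
    (measurable_ennExt hu.1).comp measurable_snd
  have hloss := π.lintegral_prod_jumpRate_ne_top γ hw hγ (hw'.jumpBounded_ennExt_fst hu) t
  have hgain := π.lintegral_prod_jumpRate_ne_top γ hw hγ (hw'.jumpBounded_ennExt_snd hu) t
  have hmfst := π.measurable_prod_jumpRate hfst
  have hmsnd := π.measurable_prod_jumpRate hsnd
  simp_rw [π.drift_of_nonneg hw' hu hu0]
  rw [integral_sub (integrable_toReal_of_lintegral_ne_top hmsnd.aemeasurable hgain)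
      (integrable_toReal_of_lintegral_ne_top hmfst.aemeasurable hloss),
    integral_toReal hmsnd.aemeasurable (ae_lt_top hmsnd hgain),
    integral_toReal hmfst.aemeasurable (ae_lt_top hmfst hloss)]

theorem integral_process_sub_of_nonneg (hw : M.IsLyapunov w) (hw' : M.IsSecondWeight w w')
    (hγ : Integrable w γ) (hu : WeightedBounded w' u) (hu0 : ∀ x, 0 ≤ u x) (t : ℝ≥0) :
    ∫ ω, extendZero u (PathSpace.process t ω) ∂(π.law γ) - ∫ x, u x ∂γ
      = ∫ p : PathSpace S × ℝ, π.drift u p.2.toNNReal p.1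
        ∂((π.law γ).prod (volume.restrict (Ioc 0 (t : ℝ)))) := by
  have hm := measurable_ennExt hu.1
  have hmprocess : Measurable fun ω : PathSpace S => ennExt u (PathSpace.process t ω) :=
    hm.comp (PathSpace.measurable_process.comp measurable_prodMk_left)
  have hminit : Measurable fun x => ennExt u (Sum.inl x) := hm.comp measurable_inl
  have hprocess : ∫⁻ ω, ennExt u (PathSpace.process t ω) ∂(π.law γ) ≠ ∞ :=
    hw'.lintegral_ennExt_comp_ne_top hu (π.lintegral_ennExt_process_ne_top γ hw hγ t)
  have hstart : ∫⁻ x, ennExt u (Sum.inl x) ∂γ ≠ ∞ :=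
    hw'.lintegral_ennExt_comp_ne_top hu (ξ := Sum.inl) hγ.lintegral_lt_top.ne
  have hbalance := congrArg ENNReal.toReal (π.lintegral_process_add_lintegral_jumpRate γ
    (π.ae_exists_mem_sojourn γ hw hγ t) hm)
  rw [ENNReal.toReal_add hprocess
      (π.lintegral_prod_jumpRate_ne_top γ hw hγ (hw'.jumpBounded_ennExt_fst hu) t),
    ENNReal.toReal_add hstart
      (π.lintegral_prod_jumpRate_ne_top γ hw hγ (hw'.jumpBounded_ennExt_snd hu) t),
    ← integral_toReal hmprocess.aemeasurable (ae_lt_top hmprocess hprocess),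
    ← integral_toReal hminit.aemeasurable (ae_lt_top hminit hstart)] at hbalance
  simp only [toReal_ennExt hu0, extendZero, Sum.elim_inl] at hbalance
  rw [π.integral_prod_drift_of_nonneg γ hw hw' hγ hu hu0]
  simp only [extendZero]
  linarith

theorem integral_process_sub (hw : M.IsLyapunov w) (hw' : M.IsSecondWeight w w')
    (hγ : Integrable w γ) (hu : WeightedBounded w' u) (t : ℝ≥0) :
    ∫ ω, extendZero u (PathSpace.process t ω) ∂(π.law γ) - ∫ x, u x ∂γ
      = ∫ p : PathSpace S × ℝ, π.drift u p.2.toNNReal p.1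
        ∂((π.law γ).prod (volume.restrict (Ioc 0 (t : ℝ)))) := by
  refine WeightedBounded.induction_sub (P := fun v =>
    ∫ ω, extendZero v (PathSpace.process t ω) ∂(π.law γ) - ∫ x, v x ∂γ
      = ∫ p : PathSpace S × ℝ, π.drift v p.2.toNNReal p.1 ∂_) hw'.one_le hu
    (fun v hv hv0 => π.integral_process_sub_of_nonneg γ hw hw' hγ hv hv0 t)
    fun v₁ v₂ hv₁ hv₂ h₁ h₂ => ?_
  have hstart : ∀ v, WeightedBounded w' v → Integrable v γ := fun v hv =>
    hw'.integrable_extendZero_comp hv measurable_inl (ξ := Sum.inl) hγ.lintegral_lt_top.ne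
  simp_rw [extendZero_sub, π.drift_sub hw' hv₁ hv₂, Pi.sub_apply]
  rw [integral_sub (π.integrable_process γ hw hw' hγ hv₁ t)
      (π.integrable_process γ hw hw' hγ hv₂ t), integral_sub (hstart v₁ hv₁) (hstart v₂ hv₂),
    integral_sub (π.integrable_prod_drift γ hw hw' hγ hv₁ t)
      (π.integrable_prod_drift γ hw hw' hγ hv₂ t), ← h₁, ← h₂]
  ring

end Formula

end Dynkin

end Policy

section Discount

theorem integral_exp_mul_neg_mul_add {m d : ℝ → ℝ} {m₀ α t : ℝ} (ht : 0 ≤ t)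
    (hd : IntervalIntegrable d volume 0 t)
    (hm : ∀ v ∈ Icc 0 t, m v = m₀ + ∫ s in (0 : ℝ)..v, d s) :
    ∫ v in (0 : ℝ)..t, Real.exp (-α * v) * (-α * m v + d v) = m t * Real.exp (-α * t) - m₀ := by
  set g : ℝ → ℝ := fun v => m₀ + ∫ s in (0 : ℝ)..v, d s with hg
  have hexp : AbsolutelyContinuousOnInterval (fun v => Real.exp (-α * v)) 0 t :=
    ContDiffOn.absolutelyContinuousOnInterval (by fun_prop)
  have hgac : AbsolutelyContinuousOnInterval g 0 t :=
    (ContDiffOn.absolutelyContinuousOnInterval (f := fun _ => m₀) (by fun_prop)).add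
      (hd.absolutelyContinuousOnInterval_intervalIntegral (by simp))
  have hderiv : ∫ v in (0 : ℝ)..t, Real.exp (-α * v) * (-α * m v + d v)
      = ∫ v in (0 : ℝ)..t, deriv (fun v => Real.exp (-α * v)) v * g v
        + Real.exp (-α * v) * deriv g v := by
    refine intervalIntegral.integral_congr_ae ?_
    filter_upwards [hd.ae_hasDerivAt_integral] with v hv hvt
    have hdg : deriv g v = d v :=
      ((hv (uIoc_subset_uIcc hvt) 0 (by simp)).const_add m₀).deriv
    have hdexp : deriv (fun v => Real.exp (-α * v)) v = Real.exp (-α * v) * -α := by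
      simpa using ((hasDerivAt_id v).const_mul (-α)).exp.deriv
    rw [uIoc_of_le ht] at hvt
    rw [hdg, hdexp, hm v (Ioc_subset_Icc_self hvt)]
    ring
  rw [hderiv, hexp.integral_deriv_mul_eq_sub hgac, hm t ⟨ht, le_rfl⟩]
  simp only [hg, intervalIntegral.integral_same, mul_zero, Real.exp_zero]
  ring

theorem integrable_prod_exp_mul {X : Type*} [MeasurableSpace X] {μ : Measure X} {f : X × ℝ → ℝ}
    {t : ℝ} (hf : Integrable f (μ.prod (volume.restrict (Ioc 0 t)))) (α : ℝ) :
    Integrable (fun p => Real.exp (α * p.2) * f p) (μ.prod (volume.restrict (Ioc 0 t))) := by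
  have hbound : ∀ᵐ v ∂(volume.restrict (Ioc 0 t)), ‖Real.exp (α * v)‖ ≤ Real.exp (|α| * t) := by
    filter_upwards [ae_restrict_mem measurableSet_Ioc] with v hv
    rw [Real.norm_of_nonneg (Real.exp_nonneg _), Real.exp_le_exp]
    exact mul_le_mul (le_abs_self α) hv.2 hv.1.le (abs_nonneg α)
  exact hf.bdd_mul (by fun_prop) (Measure.quasiMeasurePreserving_snd.ae hbound)

end Discount

namespace Policy

section DiscountedDynkin

variable {S A : Type*} [MeasurableSpace S] [MeasurableSpace A] [StandardBorelSpace S]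
  {M : Model S A} (π : Policy M) (γ : Measure S) [IsProbabilityMeasure γ] {w w' u : S → ℝ}

theorem integral_process_eq_add (hw : M.IsLyapunov w) (hw' : M.IsSecondWeight w w')
    (hγ : Integrable w γ) (hu : WeightedBounded w' u) {v : ℝ} (hv : 0 ≤ v) :
    ∫ ω, extendZero u (PathSpace.process v.toNNReal ω) ∂(π.law γ)
      = ∫ x, u x ∂γ + ∫ s in (0 : ℝ)..v, ∫ ω, π.drift u s.toNNReal ω ∂(π.law γ) := by
  have hdynkin := π.integral_process_sub γ hw hw' hγ hu v.toNNReal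
  rw [integral_prod_symm _ (π.integrable_prod_drift γ hw hw' hγ hu _), Real.coe_toNNReal v hv,
    ← intervalIntegral.integral_of_le hv] at hdynkin
  linarith

theorem integrable_prod_discounted (hw : M.IsLyapunov w) (hw' : M.IsSecondWeight w w')
    (hγ : Integrable w γ) (hu : WeightedBounded w' u) (α : ℝ) (t : ℝ≥0) :
    Integrable (fun p : PathSpace S × ℝ => Real.exp (-α * p.2) *
        (-α * extendZero u (PathSpace.process p.2.toNNReal p.1) + π.drift u p.2.toNNReal p.1))
      ((π.law γ).prod (volume.restrict (Ioc 0 (t : ℝ)))) :=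
  integrable_prod_exp_mul (((π.integrable_prod_process γ hw hw' hγ hu t).const_mul (-α)).add
    (π.integrable_prod_drift γ hw hw' hγ hu t)) (-α)

theorem integral_process_mul_exp_sub (hw : M.IsLyapunov w) (hw' : M.IsSecondWeight w w')
    (hγ : Integrable w γ) (hu : WeightedBounded w' u) (α : ℝ) (t : ℝ≥0) :
    (∫ ω, extendZero u (PathSpace.process t ω) ∂(π.law γ)) * Real.exp (-α * t) - ∫ x, u x ∂γ
      = ∫ p : PathSpace S × ℝ, Real.exp (-α * p.2) *
          (-α * extendZero u (PathSpace.process p.2.toNNReal p.1) + π.drift u p.2.toNNReal p.1)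
        ∂((π.law γ).prod (volume.restrict (Ioc 0 (t : ℝ)))) := by
  have ht : 0 ≤ (t : ℝ) := t.coe_nonneg
  have hdrift := π.integrable_prod_drift γ hw hw' hγ hu t
  have hparts := integral_exp_mul_neg_mul_add (α := α) ht
    ((intervalIntegrable_iff_integrableOn_Ioc_of_le ht).2 hdrift.integral_prod_right)
    fun v hv => π.integral_process_eq_add γ hw hw' hγ hu hv.1
  rw [Real.toNNReal_coe] at hparts
  rw [← hparts, intervalIntegral.integral_of_le ht,
    integral_prod_symm _ (π.integrable_prod_discounted γ hw hw' hγ hu α t)]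
  refine integral_congr_ae ?_
  filter_upwards [hdrift.prod_left_ae] with v hv
  rw [integral_const_mul, integral_add
    ((π.integrable_process γ hw hw' hγ hu v.toNNReal).const_mul (-α)) hv, integral_const_mul]

end DiscountedDynkin

end Policy

end CTMDP

end

theorem theorem2_general {S A : Type*} [MeasurableSpace S] [StandardBorelSpace S]
    [MeasurableSpace A] (M : Model S A) (w w' : S → ℝ) (hw : M.IsLyapunov w)
    (hw' : M.IsSecondWeight w w') (α : ℝ) (π : Policy M) (u : S → ℝ) (hu : WeightedBounded w' u)
    (γ : Measure S) [IsProbabilityMeasure γ] (hγ : Integrable w γ) (t : ℝ≥0) :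
    (∀ y, ∀ a ∈ M.adm y, (M.q y a).Integrable u) ∧
    (∀ v ω, Integrable (M.generator u (PathSpace.process v ω)) (π.prob v ω)) ∧
    π.law γ {ω | PathSpace.process t ω ∈ Set.range Sum.inl} = 1 ∧
    Integrable (fun ω => extendZero u (PathSpace.process t ω)) (π.law γ) ∧
    Integrable (fun p : PathSpace S × ℝ => π.drift u p.2.toNNReal p.1)
      ((π.law γ).prod (volume.restrict (Set.Ioc 0 (t : ℝ)))) ∧
    Integrable (fun p : PathSpace S × ℝ => Real.exp (-α * p.2) *
        (-α * extendZero u (PathSpace.process p.2.toNNReal p.1) + π.drift u p.2.toNNReal p.1))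
      ((π.law γ).prod (volume.restrict (Set.Ioc 0 (t : ℝ)))) ∧
    (∫ ω, extendZero u (PathSpace.process t ω) ∂(π.law γ)) - ∫ x, u x ∂γ =
      ∫ ω, (∫ v in (0 : ℝ)..t, π.drift u v.toNNReal ω) ∂(π.law γ) ∧
    (∫ ω, extendZero u (PathSpace.process t ω) ∂(π.law γ)) * Real.exp (-α * t) - ∫ x, u x ∂γ =
      ∫ ω, (∫ v in (0 : ℝ)..t, Real.exp (-α * v) *
        (-α * extendZero u (PathSpace.process v.toNNReal ω) + π.drift u v.toNNReal ω))
        ∂(π.law γ) := by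
  have hdrift := π.integrable_prod_drift γ hw hw' hγ hu t
  have hdiscounted := π.integrable_prod_discounted γ hw hw' hγ hu α t
  have hprob : ∀ v ω, IsProbabilityMeasure (π.prob v ω) := π.isProbabilityMeasure
  refine ⟨fun y a _ => hw'.integrable_q hu y a,
    fun v ω => hw'.integrable_generator hu (PathSpace.process v ω) (π.prob v ω),
    π.law_process_mem_range_inl γ hw hγ t, π.integrable_process γ hw hw' hγ hu t, hdrift,
    hdiscounted, ?_, ?_⟩
  · simp_rw [intervalIntegral.integral_of_le t.coe_nonneg]
    rw [π.integral_process_sub γ hw hw' hγ hu t, integral_prod _ hdrift]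
  · simp_rw [intervalIntegral.integral_of_le t.coe_nonneg]
    rw [π.integral_process_mul_exp_sub γ hw hw' hγ hu α t, integral_prod _ hdiscounted]

theorem theorem2 {S A : Type*} [MeasurableSpace S] [StandardBorelSpace S]
    [MeasurableSpace A] [StandardBorelSpace A] (M : Model S A) (w w' : S → ℝ)
    (hw : M.IsLyapunov w) (hw' : M.IsSecondWeight w w') (α : ℝ) (hα : 0 < α)
    (π : Policy M) (u : S → ℝ) (hu : WeightedBounded w' u) (x : S) (t : ℝ≥0) :
    -- all the expressions in the two formulas are well defined
    (∀ y, ∀ a ∈ M.adm y, (M.q y a).Integrable u) ∧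
    (∀ v ω, Integrable (M.generator u (PathSpace.process v ω)) (π.prob v ω)) ∧
    π.lawFrom x {ω | PathSpace.process t ω ∈ Set.range Sum.inl} = 1 ∧
    Integrable (fun ω => extendZero u (PathSpace.process t ω)) (π.lawFrom x) ∧
    Integrable (fun p : PathSpace S × ℝ => π.drift u p.2.toNNReal p.1)
      ((π.lawFrom x).prod (volume.restrict (Set.Ioc 0 (t : ℝ)))) ∧
    Integrable (fun p : PathSpace S × ℝ => Real.exp (-α * p.2) *
        (-α * extendZero u (PathSpace.process p.2.toNNReal p.1) + π.drift u p.2.toNNReal p.1))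
      ((π.lawFrom x).prod (volume.restrict (Set.Ioc 0 (t : ℝ)))) ∧
    -- Dynkin's formula
    (∫ ω, extendZero u (PathSpace.process t ω) ∂(π.lawFrom x)) - u x =
      ∫ ω, (∫ v in (0 : ℝ)..t, π.drift u v.toNNReal ω) ∂(π.lawFrom x) ∧
    -- Dynkin's formula, discounted version
    (∫ ω, extendZero u (PathSpace.process t ω) ∂(π.lawFrom x)) * Real.exp (-α * t) - u x =
      ∫ ω, (∫ v in (0 : ℝ)..t, Real.exp (-α * v) *
        (-α * extendZero u (PathSpace.process v.toNNReal ω) + π.drift u v.toNNReal ω))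
        ∂(π.lawFrom x) := by
  simpa only [Policy.lawFrom, integral_dirac] using
    theorem2_general M w w' hw hw' α π u hu (Measure.dirac x) (integrable_dirac (by simp)) t
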